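/- Let $\rho_0,\rho_1$ be density operators (positive semidefinite, trace one) on $\mathbb C^D$. For $t\in[0,1]$ consider the binary channel that sends $\rho_0,\rho_1$ with prior probabilities $1-t$ and $t$, and put $\rho=\rho(t)=(1-t)\rho_0+t\rho_1$ and $\Delta=\rho_1-\rho_0$. A POVM is a finite family $E=(E_b)$ of positive semidefinite operators with $\sum_bE_b=\mathbb 1$; its outcome distributions are $p_k(b)=\mathrm{tr}(\rho_kE_b)$ and $p(b)=\mathrm{tr}(\rho E_b)$. With $H(q)=-\sum_bq(b)\ln q(b)$ (where $0\ln0=0$), let $J_E(t)=H(p)-(1-t)H(p_0)-tH(p_1)$ be the mutual information and let the accessible information $I(t)$ be the maximum of $J_E(t)$ over all POVMs $E$ (this maximum exists). Let $S(\rho)=-\mathrm{tr}(\rho\ln\rho)$ be the von Neumann entropy and $S(t)=S(\rho)-(1-t)S(\rho_0)-tS(\rho_1)$. With an orthonormal eigenbasis $|j\rangle$ of $\rho$ with eigenvalues $\lambda_j$, put $$\mathcal L_\rho(\Delta)=\sum_{j,k:\ \lambda_j+\lambda_k\neq0}\frac{2}{\lambda_j+\lambda_k}\,\langle j|\Delta|k\rangle\,|j\rangle\langle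 k| .$$ Then: (a) For $0<t<1$ the operator $\mathcal L_\rho(\Delta)$ is Hermitian and satisfies $\tfrac12\bigl(\rho\,\mathcal L_\rho(\Delta)+\mathcal L_\rho(\Delta)\,\rho\bigr)=\Delta$. (b) For every POVM $E$ the function $J_E$ is twice continuously differentiable on $(0,1)$, and for $0<t<1$ $$\min_E J_E''(t)=-\mathrm{tr}\bigl(\Delta\,\mathcal L_\rho(\Delta)\bigr),$$ the minimum being attained by the projectors $E_b=|b\rangle\langle b|$ onto any orthonormal eigenbasis $(|b\rangle)$ of $\mathcal L_\rho(\Delta)$. (c) There is exactly one continuous function $L:[0,1]\to\mathbb R$ that is twice differentiable on $(0,1)$ with $L''(t)=-\mathrm{tr}\bigl(\Delta\,\mathcal L_{\rho(t)}(\Delta)\bigr)$ there and with $L(0)=L(1)=0$; and for all $t\in[0,1]$ $$I(t)\le L(t)\le S(t)=S(\rho)-(1-t)S(\rho_0)-tS(\rho_1).$$ (d) For $0<t<1$, $I(t)=S(t)$ if and only if $\rho_0$ and $\rho_1$ commute. -/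

import Mathlib

open scoped Matrix ComplexOrder

noncomputable section

namespace BinaryChannel

variable {n : Type*} [Fintype n]

/-- A density operator on the `D`-dimensional Hilbert space `ℂ^n`, `D = card n`. -/
structure DensityOperator (n : Type*) [Fintype n] where
  op : Matrix n n ℂ
  posSemidef : op.PosSemidef
  trace_eq_one : op.trace = 1

/-- The mean operator `ρ(t) = (1 - t) ρ₀ + t ρ₁` of the channel with priors `1 - t` and `t`. -/
def mean (ρ₀ ρ₁ : DensityOperator n) (t : ℝ) : Matrix n n ℂ :=
  ((1 - t : ℝ) : ℂ) • ρ₀.op + (t : ℂ) • ρ₁.op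

/-- The difference operator `Δ = ρ₁ - ρ₀`. -/
def diff (ρ₀ ρ₁ : DensityOperator n) : Matrix n n ℂ := ρ₁.op - ρ₀.op

theorem mean_isHermitian (ρ₀ ρ₁ : DensityOperator n) (t : ℝ) : (mean ρ₀ ρ₁ t).IsHermitian := by
  have h₀ := ρ₀.posSemidef.isHermitian.eq
  have h₁ := ρ₁.posSemidef.isHermitian.eq
  simp [mean, Matrix.IsHermitian, Matrix.conjTranspose_add, Matrix.conjTranspose_smul, h₀, h₁]

variable [DecidableEq n]

/-- A measurement (POVM) with outcomes `b : ι`: positive operators that sum to the identity. -/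
structure IsPOVM {ι : Type*} [Fintype ι] (E : ι → Matrix n n ℂ) : Prop where
  posSemidef : ∀ b, (E b).PosSemidef
  sum_eq_one : ∑ b, E b = 1

/-- The probability `tr(ρ E)` of an outcome with operator `E` in the state `ρ`. -/
def prob (ρ E : Matrix n n ℂ) : ℝ := (ρ * E).trace.re

/-- Shannon information `H(q) = -∑_b q(b) ln q(b)`, in nats. -/
def shannon {ι : Type*} [Fintype ι] (q : ι → ℝ) : ℝ := ∑ b, Real.negMulLog (q b)

/-- The mutual information `J(t) = H(p) - (1 - t) H(p₀) - t H(p₁)` of the channel with respect to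
the measurement `E`. -/
def mutualInfo (ρ₀ ρ₁ : DensityOperator n) {ι : Type*} [Fintype ι] (E : ι → Matrix n n ℂ)
    (t : ℝ) : ℝ :=
  shannon (fun b => prob (mean ρ₀ ρ₁ t) (E b))
    - (1 - t) * shannon (fun b => prob ρ₀.op (E b))
    - t * shannon (fun b => prob ρ₁.op (E b))

/-- All values that the mutual information takes on measurements with finitely many outcomes. -/
def mutualInfoValues (ρ₀ ρ₁ : DensityOperator n) (t : ℝ) : Set ℝ :=
  {x | ∃ (N : ℕ) (E : Fin N → Matrix n n ℂ), IsPOVM E ∧ mutualInfo ρ₀ ρ₁ E t = x}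

/-- The accessible information `I(t)`. -/
def accessibleInfo (ρ₀ ρ₁ : DensityOperator n) (t : ℝ) : ℝ :=
  sSup (mutualInfoValues ρ₀ ρ₁ t)

/-- The values at `t` of the second derivatives `J''` over all measurements. -/
def mutualInfoSecondDerivValues (ρ₀ ρ₁ : DensityOperator n) (t : ℝ) : Set ℝ :=
  {x | ∃ (N : ℕ) (E : Fin N → Matrix n n ℂ),
    IsPOVM E ∧ iteratedDeriv 2 (mutualInfo ρ₀ ρ₁ E) t = x}

/-- Von Neumann entropy `S(ρ) = -tr(ρ ln ρ) = -∑_j λ_j ln λ_j`, with `λ_j` the eigenvalues. -/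
def vonNeumannEntropy {ρ : Matrix n n ℂ} (hρ : ρ.IsHermitian) : ℝ :=
  ∑ j, Real.negMulLog (hρ.eigenvalues j)

/-- The Holevo quantity `S(t) = S(ρ) - (1 - t) S(ρ₀) - t S(ρ₁)`. -/
def holevo (ρ₀ ρ₁ : DensityOperator n) (t : ℝ) : ℝ :=
  vonNeumannEntropy (mean_isHermitian ρ₀ ρ₁ t)
    - (1 - t) * vonNeumannEntropy ρ₀.posSemidef.isHermitian
    - t * vonNeumannEntropy ρ₁.posSemidef.isHermitian

/-- The operator `𝓛_ρ(A) = ∑_{λ_j + λ_k ≠ 0} 2 / (λ_j + λ_k) ⟨j|A|k⟩ |j⟩⟨k|`, where `|j⟩` is an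
orthonormal eigenbasis of `ρ` with eigenvalues `λ_j`. -/
def lowering {ρ : Matrix n n ℂ} (hρ : ρ.IsHermitian) (A : Matrix n n ℂ) : Matrix n n ℂ :=
  let ket : n → n → ℂ := fun j => (hρ.eigenvectorBasis j).ofLp
  ∑ j, ∑ k, if hρ.eigenvalues j + hρ.eigenvalues k = 0 then 0 else
    (2 / ((hρ.eigenvalues j : ℂ) + (hρ.eigenvalues k : ℂ)) * (star (ket j) ⬝ᵥ (A *ᵥ ket k))) •
      Matrix.vecMulVec (ket j) (star (ket k))

/-- The operator `𝓛_{ρ(t)}(Δ)`. -/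
def loweredDiff (ρ₀ ρ₁ : DensityOperator n) (t : ℝ) : Matrix n n ℂ :=
  lowering (mean_isHermitian ρ₀ ρ₁ t) (diff ρ₀ ρ₁)

/-- The curvature `-tr(Δ 𝓛_{ρ(t)}(Δ))` prescribed for the bound `L` at `0 < t < 1`. -/
def curvature (ρ₀ ρ₁ : DensityOperator n) (t : ℝ) : ℝ :=
  -(diff ρ₀ ρ₁ * loweredDiff ρ₀ ρ₁ t).trace.re

/-- `L` is a function on `[0,1]` with `L'' = -tr(Δ 𝓛_ρ(Δ))` inside and `L(0) = L(1) = 0`.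
Continuity up to the end points ties the boundary values to the interior. -/
structure IsCurvatureBound (ρ₀ ρ₁ : DensityOperator n) (L : ℝ → ℝ) : Prop where
  continuousOn : ContinuousOn L (Set.Icc 0 1)
  zero : L 0 = 0
  one : L 1 = 0
  differentiableAt : ∀ t ∈ Set.Ioo (0 : ℝ) 1, DifferentiableAt ℝ L t
  hasDerivAt_deriv : ∀ t ∈ Set.Ioo (0 : ℝ) 1,
    HasDerivAt (deriv L) (curvature ρ₀ ρ₁ t) t

/-- The orthonormal basis `v` consists of eigenvectors of `A`. -/
def IsEigenbasis (v : OrthonormalBasis n ℂ (EuclideanSpace ℂ n)) (A : Matrix n n ℂ) : Prop :=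
  ∀ b, ∃ μ : ℂ, A *ᵥ (v b).ofLp = μ • (v b).ofLp

/-- The measurement in the basis `v`: the projectors `|b⟩⟨b|`. -/
def basisMeasurement (v : OrthonormalBasis n ℂ (EuclideanSpace ℂ n)) (b : n) : Matrix n n ℂ :=
  Matrix.vecMulVec (v b).ofLp (star (v b).ofLp)

end BinaryChannel

end

/-!
The second derivative of the mutual information of a measurement is minus the Fisher information of
its outcome distribution. By the Cauchy-Schwarz inequality for the form `tr(ρ X Y)`, the Fisher
information is at most `tr(Δ 𝓛_ρ(Δ))`, with equality in the eigenbasis of the symmetric logarithmic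
derivative `𝓛_ρ(Δ)`. Hence `L'' ≤ J_E''`, and since both functions vanish at the end points,
`J_E ≤ L`. The integral for `L` converges because `-tr(Δ 𝓛_ρ(Δ))` is concave in `t` and bounded by a
multiple of `1 / (t (1 - t))`. Caratheodory's theorem bounds the number of outcomes that are needed,
so that the accessible information is a maximum over a compact set.

For `L ≤ S`, Klein's inequality with an auxiliary Hermitian operator shows that at each `t` a cubic
with second derivative `L''(t)` touches the Holevo quantity `S` from above. Differentiating `S` is
thereby avoided, and the minimum principle still applies to `S - L`. The inequality used is sharper
than Klein's by the squared Hilbert-Schmidt norm of a commutator, so that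
`c t (1 - t) ‖[ρ₀, ρ₁]‖² ≤ S - L` for a constant `c > 0`, and equality forces `ρ₀` and `ρ₁` to
commute. If they do commute, the measurement in a joint eigenbasis attains `S`.
-/

namespace BinaryChannel

open Set Filter Topology

section SecondDerivative

/-- `φ` is differentiable around `t` and its derivative has the derivative `c` at `t`. -/
def HasSecondDerivAt (φ : ℝ → ℝ) (c t : ℝ) : Prop :=
  ∃ φ' : ℝ → ℝ, (∀ᶠ s in 𝓝 t, HasDerivAt φ (φ' s) s) ∧ HasDerivAt φ' c t

variable {φ ψ : ℝ → ℝ} {c d t : ℝ}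

theorem HasSecondDerivAt.add (hφ : HasSecondDerivAt φ c t) (hψ : HasSecondDerivAt ψ d t) :
    HasSecondDerivAt (fun s => φ s + ψ s) (c + d) t := by
  obtain ⟨φ', hφ', hφ''⟩ := hφ
  obtain ⟨ψ', hψ', hψ''⟩ := hψ
  exact ⟨fun s => φ' s + ψ' s, by filter_upwards [hφ', hψ'] with s h₁ h₂ using h₁.add h₂,
    hφ''.add hψ''⟩

theorem HasSecondDerivAt.const_mul (r : ℝ) (hφ : HasSecondDerivAt φ c t) :
    HasSecondDerivAt (fun s => r * φ s) (r * c) t := by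
  obtain ⟨φ', hφ', hφ''⟩ := hφ
  exact ⟨fun s => r * φ' s, by filter_upwards [hφ'] with s h using h.const_mul r,
    hφ''.const_mul r⟩

theorem HasSecondDerivAt.sub (hφ : HasSecondDerivAt φ c t) (hψ : HasSecondDerivAt ψ d t) :
    HasSecondDerivAt (fun s => φ s - ψ s) (c - d) t := by
  simpa only [neg_one_mul, ← sub_eq_add_neg] using hφ.add (hψ.const_mul (-1))

theorem HasSecondDerivAt.sum {ι : Type*} (u : Finset ι) {φ : ι → ℝ → ℝ} {c : ι → ℝ}
    (h : ∀ b ∈ u, HasSecondDerivAt (φ b) (c b) t) :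
    HasSecondDerivAt (fun s => ∑ b ∈ u, φ b s) (∑ b ∈ u, c b) t := by
  classical
  induction u using Finset.induction_on with
  | empty =>
    simp only [Finset.sum_empty]
    exact ⟨0, .of_forall fun s => hasDerivAt_const s 0, hasDerivAt_const t 0⟩
  | insert b u hb ih =>
    simp only [Finset.sum_insert hb]
    exact (h b (u.mem_insert_self b)).add (ih fun d hd => h d (Finset.mem_insert_of_mem hd))

theorem HasSecondDerivAt.iteratedDeriv_two (hφ : HasSecondDerivAt φ c t) :
    iteratedDeriv 2 φ t = c := by
  obtain ⟨φ', hφ', hφ''⟩ := hφ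
  rw [iteratedDeriv_succ, iteratedDeriv_one]
  exact (hφ''.congr_of_eventuallyEq (hφ'.mono fun s hs => hs.deriv)).deriv

theorem HasSecondDerivAt.not_isLocalMin (hφ : HasSecondDerivAt φ c t) (hc : c < 0) :
    ¬ IsLocalMin φ t := by
  intro hmin
  obtain ⟨φ', hφ', hφ''⟩ := hφ
  have hderiv : deriv φ =ᶠ[𝓝 t] φ' := hφ'.mono fun s hs => hs.deriv
  have hmax : IsLocalMax φ t := by
    refine isLocalMax_of_deriv_deriv_neg ?_ hmin.deriv_eq_zero hφ'.self_of_nhds.continuousAt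
    rw [hderiv.deriv_eq, hφ''.deriv]
    exact hc
  have hconst : φ =ᶠ[𝓝 t] fun _ => φ t := by
    filter_upwards [hmin, hmax] with s h₁ h₂ using le_antisymm h₂ h₁
  have hzero : deriv φ =ᶠ[𝓝 t] 0 := by
    filter_upwards [hconst.deriv] with s hs
    simp [hs]
  exact hc.ne ((hφ''.congr_of_eventuallyEq (hzero.symm.trans hderiv)).unique
    (hasDerivAt_const t 0))

theorem hasSecondDerivAt_cubic (c₀ c₁ c₂ c₃ t : ℝ) :
    HasSecondDerivAt (fun s => c₀ + c₁ * (s - t) + c₂ / 2 * (s - t) ^ 2 + c₃ * (s - t) ^ 3)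
      c₂ t := by
  refine ⟨fun s => c₁ + c₂ * (s - t) + 3 * c₃ * (s - t) ^ 2, .of_forall fun s => ?_, ?_⟩
  · have h := (hasDerivAt_id' s).sub_const t
    exact ((((h.const_mul c₁).const_add c₀).fun_add ((h.fun_pow 2).const_mul (c₂ / 2))).fun_add
      ((h.fun_pow 3).const_mul c₃)).congr_deriv (by push_cast; ring)
  · have h := (hasDerivAt_id' t).sub_const t
    exact (((h.const_mul c₂).const_add c₁).fun_add ((h.fun_pow 2).const_mul (3 * c₃))).congr_deriv
      (by simp)

end SecondDerivative

section MinimumPrinciple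

variable {f : ℝ → ℝ} {a b : ℝ}

theorem nonneg_of_touchedAbove_neg (hf : ContinuousOn f (Icc a b)) (ha : 0 ≤ f a) (hb : 0 ≤ f b)
    (htouch : ∀ t ∈ Ioo a b, ∃ φ c,
      f ≤ᶠ[𝓝 t] φ ∧ φ t = f t ∧ HasSecondDerivAt φ c t ∧ c < 0) :
    ∀ t ∈ Icc a b, 0 ≤ f t := by
  intro t ht
  obtain ⟨m, hm, hmin⟩ := isCompact_Icc.exists_isMinOn ⟨t, ht⟩ hf
  refine le_trans ?_ (hmin ht)
  rcases eq_endpoints_or_mem_Ioo_of_mem_Icc hm with rfl | rfl | hm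
  · exact ha
  · exact hb
  obtain ⟨φ, c, hle, heq, hφ, hc⟩ := htouch m hm
  refine absurd ?_ (hφ.not_isLocalMin hc)
  filter_upwards [hle, Icc_mem_nhds hm.1 hm.2] with s hs hs'
  exact heq.trans_le ((hmin hs').trans hs)

theorem nonneg_of_touchedAbove (hf : ContinuousOn f (Icc a b)) (ha : 0 ≤ f a) (hb : 0 ≤ f b)
    (htouch : ∀ t ∈ Ioo a b, ∃ φ c,
      f ≤ᶠ[𝓝 t] φ ∧ φ t = f t ∧ HasSecondDerivAt φ c t ∧ c ≤ 0) :
    ∀ t ∈ Icc a b, 0 ≤ f t := by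
  have hperturbed : ∀ ε > 0, ∀ t ∈ Icc a b, 0 ≤ f t + ε * ((t - a) * (b - t)) := by
    intro ε hε
    refine nonneg_of_touchedAbove_neg (by fun_prop) (by simpa using ha) (by simpa using hb) ?_
    intro t ht
    obtain ⟨φ, c, hle, heq, hφ, hc⟩ := htouch t ht
    have hparabola : HasSecondDerivAt (fun s => (s - a) * (b - s)) (-2) t := by
      convert hasSecondDerivAt_cubic ((t - a) * (b - t)) (b - t - (t - a)) (-2) 0 t using 2
      ring
    refine ⟨_, _, ?_, ?_, hφ.add (hparabola.const_mul ε), by linarith⟩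
    · filter_upwards [hle] with s hs using by gcongr
    · simp [heq]
  intro t ht
  have hlim : Tendsto (fun ε => f t + ε * ((t - a) * (b - t))) (𝓝[>] 0) (𝓝 (f t)) := by
    have : ContinuousAt (fun ε => f t + ε * ((t - a) * (b - t))) 0 := by fun_prop
    simpa [ContinuousAt] using this.tendsto.mono_left nhdsWithin_le_nhds
  exact ge_of_tendsto hlim (eventually_mem_nhdsWithin.mono fun ε hε => hperturbed ε hε t ht)

theorem nonneg_of_secondDeriv_nonpos (hf : ContinuousOn f (Icc a b)) (ha : 0 ≤ f a)
    (hb : 0 ≤ f b) (hf'' : ∀ t ∈ Ioo a b, ∃ c ≤ 0, HasSecondDerivAt f c t) :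
    ∀ t ∈ Icc a b, 0 ≤ f t :=
  nonneg_of_touchedAbove hf ha hb fun t ht =>
    let ⟨c, hc, h⟩ := hf'' t ht
    ⟨f, c, .rfl, rfl, h, hc⟩

end MinimumPrinciple

section SecondPrimitive

open MeasureTheory intervalIntegral

variable {E : Type*} [NormedAddCommGroup E] {c : ℝ → E} {K t : ℝ}

theorem intervalIntegrable_of_norm_le_of_continuousOn_Ioo {g : ℝ → ℝ}
    (hc : ContinuousOn c (Ioo 0 1)) (hg : IntervalIntegrable g volume 0 1)
    (hle : ∀ t ∈ Ioo (0 : ℝ) 1, ‖c t‖ ≤ ‖g t‖) : IntervalIntegrable c volume 0 1 := by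
  have hrestrict : (volume : Measure ℝ).restrict (uIoc 0 1) = volume.restrict (Ioo 0 1) := by
    rw [uIoc_of_le zero_le_one, restrict_Ioo_eq_restrict_Ioc]
  refine hg.mono_fun ?_ ?_ <;> rw [hrestrict]
  · exact hc.aestronglyMeasurable measurableSet_Ioo
  · exact (ae_restrict_mem measurableSet_Ioo).mono hle

variable [NormedSpace ℝ E]

theorem uIcc_subset_Ioo_of_mem {x y : ℝ} (hx : x ∈ Ioo (0 : ℝ) 1) (hy : y ∈ Ioo (0 : ℝ) 1) :
    uIcc x y ⊆ Ioo 0 1 :=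
  ordConnected_Ioo.uIcc_subset hx hy

theorem hasDerivAt_log_sub_log_one_sub (ht : t ∈ Ioo (0 : ℝ) 1) :
    HasDerivAt (fun s => Real.log s - Real.log (1 - s)) (1 / (t * (1 - t))) t := by
  have h₀ : t ≠ 0 := ht.1.ne'
  have h₁ : 1 - t ≠ 0 := (sub_pos.2 ht.2).ne'
  refine ((Real.hasDerivAt_log h₀).fun_sub (((hasDerivAt_id' t).const_sub 1).log h₁)).congr_deriv ?_
  field_simp
  ring

theorem norm_integral_le_of_norm_le_div (ht : t ∈ Ioo (0 : ℝ) 1)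
    (hK : ∀ s ∈ Ioo (0 : ℝ) 1, ‖c s‖ ≤ K / (s * (1 - s))) :
    ‖∫ s in (1 / 2)..t, c s‖ ≤ |K * (Real.log t - Real.log (1 - t))| := by
  have hsub := uIcc_subset_Ioo_of_mem (x := 1 / 2) (by norm_num) ht
  have hcont : ContinuousOn (fun s : ℝ => K * (1 / (s * (1 - s)))) (uIcc (1 / 2) t) := by
    refine continuousOn_const.mul (continuousOn_const.div (by fun_prop) fun s hs => ?_)
    exact (mul_pos (hsub hs).1 (sub_pos.2 (hsub hs).2)).ne'
  have hint : ∫ s in (1 / 2)..t, K * (1 / (s * (1 - s))) =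
      K * (Real.log t - Real.log (1 - t)) := by
    rw [integral_eq_sub_of_hasDerivAt (fun s hs =>
      (hasDerivAt_log_sub_log_one_sub (hsub hs)).const_mul K) hcont.intervalIntegrable]
    norm_num
  rw [← hint]
  refine norm_integral_le_abs_of_norm_le ?_ hcont.intervalIntegrable
  filter_upwards [ae_restrict_mem measurableSet_uIoc] with s hs
  rw [mul_one_div]
  exact hK s (hsub (uIoc_subset_uIcc hs))

theorem intervalIntegrable_log_sub_log_one_sub :
    IntervalIntegrable (fun t => Real.log t - Real.log (1 - t)) volume 0 1 := by
  have hlog : IntervalIntegrable Real.log volume 0 1 := intervalIntegrable_log'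
  have hlog' : IntervalIntegrable (fun t : ℝ => Real.log (1 - t)) volume 0 1 := by
    simpa using (hlog.comp_sub_left 1).symm
  exact hlog.sub hlog'

variable [CompleteSpace E]

theorem hasDerivAt_integral_of_continuousOn_Ioo {x : ℝ} (hc : ContinuousOn c (Ioo 0 1))
    (hx : IntervalIntegrable c volume x t) (ht : t ∈ Ioo (0 : ℝ) 1) :
    HasDerivAt (fun u => ∫ s in x..u, c s) (c t) t :=
  integral_hasDerivAt_right hx
    (hc.stronglyMeasurableAtFilter isOpen_Ioo t ht) (hc.continuousAt (isOpen_Ioo.mem_nhds ht))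

/- A singularity of order `1 / (t (1 - t))` integrates to a logarithmic, hence integrable, one. -/
theorem exists_second_primitive (hc : ContinuousOn c (Ioo 0 1))
    (hK : ∀ t ∈ Ioo (0 : ℝ) 1, ‖c t‖ ≤ K / (t * (1 - t))) :
    ∃ L L' : ℝ → E, ContinuousOn L (Icc 0 1) ∧ L 0 = 0 ∧ L 1 = 0 ∧
      ∀ t ∈ Ioo (0 : ℝ) 1, HasDerivAt L (L' t) t ∧ HasDerivAt L' (c t) t := by
  let A : ℝ → E := fun t => ∫ s in (1 / 2)..t, c s
  have hA : ∀ t ∈ Ioo (0 : ℝ) 1, HasDerivAt A (c t) t := fun t ht =>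
    hasDerivAt_integral_of_continuousOn_Ioo hc
      (hc.mono (uIcc_subset_Ioo_of_mem (by norm_num) ht)).intervalIntegrable ht
  have hA_cont : ContinuousOn A (Ioo 0 1) := fun t ht => (hA t ht).continuousAt.continuousWithinAt
  have hA_int : IntervalIntegrable A volume 0 1 :=
    intervalIntegrable_of_norm_le_of_continuousOn_Ioo hA_cont
      (intervalIntegrable_log_sub_log_one_sub.const_mul K)
      fun t ht => norm_integral_le_of_norm_le_div ht hK
  let F : ℝ → E := fun t => ∫ s in (0 : ℝ)..t, A s
  have hF_cont : ContinuousOn F (Icc 0 1) := by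
    simpa only [uIcc_of_le zero_le_one] using
      continuousOn_primitive_interval' hA_int left_mem_uIcc
  have hF : ∀ t ∈ Ioo (0 : ℝ) 1, HasDerivAt F (A t) t := fun t ht =>
    hasDerivAt_integral_of_continuousOn_Ioo hA_cont
      (hA_int.mono_set (uIcc_subset_uIcc_left
        (by simpa only [uIcc_of_le zero_le_one] using Ioo_subset_Icc_self ht))) ht
  refine ⟨fun t => F t - t • F 1, fun t => A t - F 1, by fun_prop, by simp [F], by simp,
    fun t ht => ⟨?_, (hA t ht).sub_const (F 1)⟩⟩
  simpa using (hF t ht).fun_sub ((hasDerivAt_id' t).smul_const (F 1))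

end SecondPrimitive

section RelativeEntropyScalar

theorem isMinOn_of_convexOn_of_hasDerivAt_zero {S : Set ℝ} {f : ℝ → ℝ} {x : ℝ}
    (hf : ConvexOn ℝ S f) (hx : x ∈ S) (hderiv : HasDerivAt f 0 x) : IsMinOn f S x := by
  intro y hy
  change f x ≤ f y
  rcases lt_trichotomy x y with hxy | rfl | hyx
  · have := hf.le_slope_of_hasDerivAt hx hy hxy hderiv
    rw [slope_def_field, le_div_iff₀ (sub_pos.2 hxy)] at this
    simpa using this
  · exact le_rfl
  · have := hf.slope_le_of_hasDerivAt hy hx hyx hderiv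
    rw [slope_def_field, div_le_iff₀ (sub_pos.2 hyx)] at this
    simpa using this

/-- The excess of the scalar relative entropy `a ln a - a ln b - a + b` over the Taylor-like lower
bound `3 (a - b)² / (2 (a + 2 b)) + (a - b)⁴ / 108`, whose first term is written as a polynomial
plus a multiple of `1 / (a + 2 b)`. The weights `1 : 2` are forced: this is the only denominator for
which the first term agrees with the relative entropy up to third order at `a = b`. -/
noncomputable def kleinExcess (b a : ℝ) : ℝ :=
  a * Real.log a - a * Real.log b - a + b
    - 3 / 2 * (a - 4 * b + 9 * b ^ 2 / (a + 2 * b)) - (a - b) ^ 4 / 108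

variable {a b : ℝ}

theorem hasDerivAt_kleinExcess (ha : 0 < a) (hb : 0 < b) :
    HasDerivAt (kleinExcess b) (Real.log a - Real.log b
      - 3 / 2 * (1 - 9 * b ^ 2 / (a + 2 * b) ^ 2) - (a - b) ^ 3 / 27) a := by
  have hm : a + 2 * b ≠ 0 := by positivity
  have hid := hasDerivAt_id' a
  have hfrac := ((hasDerivAt_const a (9 * b ^ 2)).fun_div (hid.add_const (2 * b)) hm)
  refine (((((Real.hasDerivAt_mul_log ha.ne').fun_sub (hid.mul_const (Real.log b))).fun_sub
    hid).add_const b).fun_sub (((hid.sub_const (4 * b)).fun_add hfrac).const_mul (3 / 2))).fun_sub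
    (((hid.sub_const b).fun_pow 4).div_const 108) |>.congr_deriv ?_
  push_cast
  ring

theorem hasDerivAt_deriv_kleinExcess (ha : 0 < a) (hb : 0 < b) :
    HasDerivAt (fun a => Real.log a - Real.log b
      - 3 / 2 * (1 - 9 * b ^ 2 / (a + 2 * b) ^ 2) - (a - b) ^ 3 / 27)
      (1 / a - 27 * b ^ 2 / (a + 2 * b) ^ 3 - (a - b) ^ 2 / 9) a := by
  have hm : a + 2 * b ≠ 0 := by positivity
  have hid := hasDerivAt_id' a
  have hfrac := (hasDerivAt_const a (9 * b ^ 2)).fun_div ((hid.add_const (2 * b)).fun_pow 2)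
    (pow_ne_zero 2 hm)
  refine ((((Real.hasDerivAt_log ha.ne').sub_const (Real.log b)).fun_sub
    ((hfrac.const_sub 1).const_mul (3 / 2))).fun_sub
    (((hid.sub_const b).fun_pow 3).div_const 27)).congr_deriv ?_
  field_simp
  push_cast
  ring

theorem secondDeriv_kleinExcess_nonneg (ha : a ∈ Ioo (0 : ℝ) 1) (hb : b ∈ Ioc (0 : ℝ) 1) :
    0 ≤ 1 / a - 27 * b ^ 2 / (a + 2 * b) ^ 3 - (a - b) ^ 2 / 9 := by
  obtain ⟨ha₀, ha₁⟩ := ha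
  obtain ⟨hb₀, hb₁⟩ := hb
  have hfactor : 1 / a - 27 * b ^ 2 / (a + 2 * b) ^ 3 - (a - b) ^ 2 / 9 =
      (a - b) ^ 2 * (9 * (a + 8 * b) - a * (a + 2 * b) ^ 3) / (9 * (a * (a + 2 * b) ^ 3)) := by
    field_simp
    ring
  have hle : a * (a + 2 * b) ^ 3 ≤ 9 * (a + 8 * b) := calc
    a * (a + 2 * b) ^ 3 = a * (a + 2 * b) ^ 2 * (a + 2 * b) := by ring
    _ ≤ 1 * 3 ^ 2 * (a + 8 * b) := by gcongr <;> linarith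
    _ = 9 * (a + 8 * b) := by ring
  have := sub_nonneg.2 hle
  rw [hfactor]
  positivity

theorem kleinExcess_nonneg (ha : a ∈ Icc (0 : ℝ) 1) (hb : b ∈ Ioc (0 : ℝ) 1) :
    0 ≤ kleinExcess b a := by
  have hcont : ContinuousOn (kleinExcess b) (Icc 0 1) := by
    have := Real.continuous_mul_log
    have hm : ∀ x ∈ Icc (0 : ℝ) 1, x + 2 * b ≠ 0 := fun x hx =>
      (add_pos_of_nonneg_of_pos hx.1 (mul_pos two_pos hb.1)).ne'
    unfold kleinExcess
    fun_prop (disch := assumption)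
  have hconvex : ConvexOn ℝ (Icc 0 1) (kleinExcess b) := by
    refine convexOn_of_hasDerivWithinAt2_nonneg (convex_Icc 0 1) hcont
      (fun x hx => (hasDerivAt_kleinExcess ?_ hb.1).hasDerivWithinAt)
      (fun x hx => (hasDerivAt_deriv_kleinExcess ?_ hb.1).hasDerivWithinAt)
      (fun x hx => secondDeriv_kleinExcess_nonneg ?_ hb) <;> rw [interior_Icc] at hx
    exacts [hx.1, hx.1, hx]
  have hb₀ := hb.1.ne'
  have hderiv : HasDerivAt (kleinExcess b) 0 b := by
    convert hasDerivAt_kleinExcess hb.1 hb.1 using 1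
    field_simp
    ring
  have hself : kleinExcess b b = 0 := by
    unfold kleinExcess
    field_simp
    ring
  rw [← hself]
  exact isMinOn_of_convexOn_of_hasDerivAt_zero hconvex ⟨hb.1.le, hb.2⟩ hderiv ha

theorem negMulLog_le_sub (ha : a ∈ Icc (0 : ℝ) 1) (hb : b ∈ Ioc (0 : ℝ) 1) :
    Real.negMulLog a ≤ -(a * Real.log b) - (a - b) - (a - b) ^ 2 / (2 * ((a + 2 * b) / 3))
      - (a - b) ^ 4 / 108 := by
  have ha₀ := ha.1
  have hb₀ := hb.1
  have hsq : (a - b) ^ 2 / (2 * ((a + 2 * b) / 3)) =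
      3 / 2 * (a - 4 * b + 9 * b ^ 2 / (a + 2 * b)) := by
    field_simp
    ring
  have hexcess : kleinExcess b a = -(a * Real.log b) - (a - b)
      - (a - b) ^ 2 / (2 * ((a + 2 * b) / 3)) - (a - b) ^ 4 / 108 - Real.negMulLog a := by
    rw [hsq, kleinExcess, Real.negMulLog]
    ring
  linarith [kleinExcess_nonneg ha hb]

end RelativeEntropyScalar

section TraceForm

variable {n ι : Type*} [Fintype n] (A B C : Matrix n n ℂ)

theorem prob_comm : prob A B = prob B A := by
  rw [prob, prob, Matrix.trace_mul_comm]

theorem prob_mul_left_comm : prob (A * B) C = prob B (C * A) := by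
  rw [prob, prob, Matrix.mul_assoc, Matrix.trace_mul_comm, Matrix.mul_assoc]

theorem prob_add_left : prob (A + B) C = prob A C + prob B C := by
  simp [prob, Matrix.add_mul]

theorem prob_add_right : prob A (B + C) = prob A B + prob A C := by
  simp [prob, Matrix.mul_add]

theorem prob_sub_left : prob (A - B) C = prob A C - prob B C := by
  simp [prob, Matrix.sub_mul]

theorem prob_smul_left (r : ℝ) : prob ((r : ℂ) • A) B = r * prob A B := by
  simp [prob]

theorem prob_smul_right (r : ℝ) : prob A ((r : ℂ) • B) = r * prob A B := by
  simp [prob]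

theorem prob_sum_right [Fintype ι] (E : ι → Matrix n n ℂ) :
    prob A (∑ b, E b) = ∑ b, prob A (E b) := by
  simp [prob, Matrix.mul_sum, Matrix.trace_sum]

theorem prob_one_right [DecidableEq n] : prob A 1 = A.trace.re := by
  rw [prob, Matrix.mul_one]

variable {A B C}

theorem prob_mul_swap (hA : A.IsHermitian) (hB : B.IsHermitian) (hC : C.IsHermitian) :
    prob (A * B) C = prob (B * A) C := by
  have h := congrArg Complex.re (Matrix.trace_conjTranspose (A * B * C))
  rw [Matrix.conjTranspose_mul, Matrix.conjTranspose_mul, hA.eq, hB.eq, hC.eq,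
    Matrix.trace_mul_comm] at h
  exact h.symm

theorem prob_vecMulVec_star (A : Matrix n n ℂ) (x : n → ℂ) :
    prob A (Matrix.vecMulVec x (star x)) = (star x ⬝ᵥ (A *ᵥ x)).re := by
  rw [prob, Matrix.mul_vecMulVec, Matrix.trace_vecMulVec, dotProduct_comm]

theorem prob_nonneg (hA : A.PosSemidef) (hB : B.PosSemidef) : 0 ≤ prob A B := by
  obtain ⟨m, v, rfl⟩ := Matrix.posSemidef_iff_eq_sum_vecMulVec.1 hB
  rw [prob_sum_right]
  refine Finset.sum_nonneg fun i _ => ?_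
  rw [prob_vecMulVec_star]
  exact hA.re_dotProduct_nonneg (v i)

theorem ofReal_prob (hA : A.IsHermitian) (hB : B.IsHermitian) :
    (prob A B : ℂ) = (A * B).trace := by
  refine Complex.conj_eq_iff_re.1 ?_
  have h := Matrix.trace_conjTranspose (A * B)
  rw [Matrix.conjTranspose_mul, hA.eq, hB.eq, Matrix.trace_mul_comm] at h
  exact h.symm

/-- The squared Hilbert-Schmidt norm `tr(A† A)`. -/
noncomputable def hilbertSchmidtSq (A : Matrix n n ℂ) : ℝ := prob Aᴴ A

end TraceForm

section MatrixElements

variable {n : Type*} [Fintype n] {u v : OrthonormalBasis n ℂ (EuclideanSpace ℂ n)}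

/-- The unitary matrix whose columns are the vectors of the orthonormal basis `v`. -/
noncomputable def ketMatrix (v : OrthonormalBasis n ℂ (EuclideanSpace ℂ n)) : Matrix n n ℂ :=
  Matrix.of fun i j => (v j).ofLp i

/-- The matrix elements `⟨uᵢ|M|vⱼ⟩` of `M` between two orthonormal bases. -/
noncomputable def matrixElements (u v : OrthonormalBasis n ℂ (EuclideanSpace ℂ n))
    (M : Matrix n n ℂ) : Matrix n n ℂ :=
  (ketMatrix u)ᴴ * M * ketMatrix v

theorem matrixElements_apply (M : Matrix n n ℂ) (i j : n) :
    matrixElements u v M i j = star (u i).ofLp ⬝ᵥ (M *ᵥ (v j).ofLp) := by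
  rw [matrixElements, Matrix.mul_assoc]
  rfl

theorem matrixElements_conjTranspose (M : Matrix n n ℂ) :
    (matrixElements u v M)ᴴ = matrixElements v u Mᴴ := by
  simp only [matrixElements, Matrix.conjTranspose_mul, Matrix.conjTranspose_conjTranspose,
    Matrix.mul_assoc]

theorem matrixElements_sub (M N : Matrix n n ℂ) :
    matrixElements u v (M - N) = matrixElements u v M - matrixElements u v N := by
  simp only [matrixElements, Matrix.mul_sub, Matrix.sub_mul]

theorem matrixElements_add (M N : Matrix n n ℂ) :
    matrixElements u v (M + N) = matrixElements u v M + matrixElements u v N := by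
  simp only [matrixElements, Matrix.mul_add, Matrix.add_mul]

theorem prob_basisMeasurement (A : Matrix n n ℂ) (v : OrthonormalBasis n ℂ (EuclideanSpace ℂ n))
    (j : n) : prob A (basisMeasurement v j) = (matrixElements v v A j j).re := by
  rw [matrixElements_apply, basisMeasurement, prob_vecMulVec_star]

theorem ketMatrix_mul_conjTranspose [DecidableEq n]
    (v : OrthonormalBasis n ℂ (EuclideanSpace ℂ n)) :
    ketMatrix v * (ketMatrix v)ᴴ = 1 :=
  (EuclideanSpace.basisFun n ℂ).toMatrix_orthonormalBasis_self_mul_conjTranspose v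

theorem ketMatrix_conjTranspose_mul [DecidableEq n]
    (v : OrthonormalBasis n ℂ (EuclideanSpace ℂ n)) :
    (ketMatrix v)ᴴ * ketMatrix v = 1 :=
  (EuclideanSpace.basisFun n ℂ).toMatrix_orthonormalBasis_conjTranspose_mul_self v

theorem matrixElements_mul (u v w : OrthonormalBasis n ℂ (EuclideanSpace ℂ n))
    (M N : Matrix n n ℂ) :
    matrixElements u w (M * N) = matrixElements u v M * matrixElements v w N := by
  classical
  calc matrixElements u w (M * N)
      = (ketMatrix u)ᴴ * M * 1 * (N * ketMatrix w) := by
        simp only [matrixElements, Matrix.mul_assoc, Matrix.one_mul]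
    _ = matrixElements u v M * matrixElements v w N := by
        simp only [← ketMatrix_mul_conjTranspose v, matrixElements, Matrix.mul_assoc]

theorem matrixElements_one [DecidableEq n] (u : OrthonormalBasis n ℂ (EuclideanSpace ℂ n)) :
    matrixElements u u 1 = 1 := by
  rw [matrixElements, Matrix.mul_one, ketMatrix_conjTranspose_mul]

theorem ketMatrix_mul_matrixElements (M : Matrix n n ℂ) :
    ketMatrix u * matrixElements u v M * (ketMatrix v)ᴴ = M := by
  classical
  calc ketMatrix u * matrixElements u v M * (ketMatrix v)ᴴ
      = (ketMatrix u * (ketMatrix u)ᴴ) * M * (ketMatrix v * (ketMatrix v)ᴴ) := by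
        simp only [matrixElements, Matrix.mul_assoc]
    _ = M := by simp only [ketMatrix_mul_conjTranspose, Matrix.one_mul, Matrix.mul_one]

theorem matrixElements_ketMatrix_mul (M : Matrix n n ℂ) :
    matrixElements u v (ketMatrix u * M * (ketMatrix v)ᴴ) = M := by
  classical
  calc matrixElements u v (ketMatrix u * M * (ketMatrix v)ᴴ)
      = ((ketMatrix u)ᴴ * ketMatrix u) * M * ((ketMatrix v)ᴴ * ketMatrix v) := by
        simp only [matrixElements, Matrix.mul_assoc]
    _ = M := by simp only [ketMatrix_conjTranspose_mul, Matrix.one_mul, Matrix.mul_one]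

theorem matrixElements_injective : Function.Injective (matrixElements u v) := fun M N h => by
  rw [← ketMatrix_mul_matrixElements (u := u) (v := v) M, h, ketMatrix_mul_matrixElements]

theorem trace_matrixElements (M : Matrix n n ℂ) : (matrixElements u u M).trace = M.trace := by
  classical
  rw [matrixElements, Matrix.trace_mul_cycle, ketMatrix_mul_conjTranspose, Matrix.one_mul]

theorem prob_conjTranspose_eq_sum (u v : OrthonormalBasis n ℂ (EuclideanSpace ℂ n))
    (M N : Matrix n n ℂ) :
    prob Mᴴ N =
      ∑ i, ∑ j, (star (matrixElements u v M i j) * matrixElements u v N i j).re := by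
  rw [prob, ← trace_matrixElements (u := v), matrixElements_mul v u v,
    ← matrixElements_conjTranspose, Matrix.trace, Complex.re_sum, Finset.sum_comm]
  simp only [Matrix.diag_apply, Matrix.mul_apply, Complex.re_sum, Matrix.conjTranspose_apply]

theorem hilbertSchmidtSq_eq_sum (u v : OrthonormalBasis n ℂ (EuclideanSpace ℂ n))
    (M : Matrix n n ℂ) :
    hilbertSchmidtSq M = ∑ i, ∑ j, ‖matrixElements u v M i j‖ ^ 2 := by
  simp only [hilbertSchmidtSq, prob_conjTranspose_eq_sum u v, Complex.star_def,
    Complex.conj_mul', ← Complex.ofReal_pow, Complex.ofReal_re]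

theorem sum_norm_sq_matrixElements_one_right [DecidableEq n] (i : n) :
    ∑ j, ‖matrixElements u v 1 i j‖ ^ 2 = 1 := by
  have h := congrFun₂ (matrixElements_mul u v u 1 1) i i
  rw [Matrix.one_mul, matrixElements_one, Matrix.one_apply_eq, Matrix.mul_apply] at h
  have hconj : ∀ j, matrixElements v u 1 j i = star (matrixElements u v 1 i j) := fun j => by
    rw [← Matrix.conjTranspose_apply, matrixElements_conjTranspose, Matrix.conjTranspose_one]
  simp only [hconj, Complex.star_def, Complex.mul_conj'] at h
  exact_mod_cast h.symm

theorem sum_norm_sq_matrixElements_one_left [DecidableEq n] (j : n) :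
    ∑ i, ‖matrixElements u v 1 i j‖ ^ 2 = 1 := by
  rw [← sum_norm_sq_matrixElements_one_right (u := v) (v := u) j]
  refine Finset.sum_congr rfl fun i _ => ?_
  rw [← norm_star, ← Matrix.conjTranspose_apply, matrixElements_conjTranspose,
    Matrix.conjTranspose_one]

end MatrixElements

section Eigensystem

variable {n : Type*} [Fintype n]
  {u v : OrthonormalBasis n ℂ (EuclideanSpace ℂ n)} {A B : Matrix n n ℂ} {a b : n → ℝ}

/-- The orthonormal basis `u` consists of eigenvectors of `A` with the real eigenvalues `a`. -/
def IsEigensystem (A : Matrix n n ℂ) (u : OrthonormalBasis n ℂ (EuclideanSpace ℂ n))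
    (a : n → ℝ) : Prop :=
  ∀ j, A *ᵥ (u j).ofLp = (a j : ℂ) • (u j).ofLp

theorem isEigensystem_eigenvectorBasis [DecidableEq n] (hA : A.IsHermitian) :
    IsEigensystem A hA.eigenvectorBasis hA.eigenvalues := fun j =>
  hA.mulVec_eigenvectorBasis j

theorem IsEigensystem.matrixElements_self [DecidableEq n] (hA : IsEigensystem A u a) :
    matrixElements u u A = Matrix.diagonal fun j => (a j : ℂ) := by
  ext i j
  have hone : matrixElements u u 1 i j = star (u i).ofLp ⬝ᵥ (u j).ofLp := by
    rw [matrixElements_apply, Matrix.one_mulVec]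
  rw [matrixElements_apply, hA j, dotProduct_smul, ← hone, matrixElements_one, smul_eq_mul,
    Matrix.one_apply, Matrix.diagonal_apply, mul_ite, mul_one, mul_zero]
  split_ifs with hij <;> simp [hij]

theorem IsEigensystem.matrixElements_mul_left (hA : IsEigensystem A u a)
    (v : OrthonormalBasis n ℂ (EuclideanSpace ℂ n)) (M : Matrix n n ℂ) (i j : n) :
    matrixElements u v (A * M) i j = a i * matrixElements u v M i j := by
  classical
  rw [matrixElements_mul u u v, hA.matrixElements_self, Matrix.diagonal_mul]

theorem IsEigensystem.matrixElements_mul_right (hA : IsEigensystem A u a)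
    (v : OrthonormalBasis n ℂ (EuclideanSpace ℂ n)) (M : Matrix n n ℂ) (i j : n) :
    matrixElements v u (M * A) i j = matrixElements v u M i j * a j := by
  classical
  rw [matrixElements_mul v u u, hA.matrixElements_self, Matrix.mul_diagonal]

theorem IsEigensystem.matrixElements_left [DecidableEq n] (hA : IsEigensystem A u a) (i j : n) :
    matrixElements u v A i j = a i * matrixElements u v 1 i j := by
  simpa only [Matrix.mul_one] using hA.matrixElements_mul_left v 1 i j

theorem IsEigensystem.matrixElements_right [DecidableEq n] (hB : IsEigensystem B v b) (i j : n) :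
    matrixElements u v B i j = matrixElements u v 1 i j * b j := by
  simpa only [Matrix.one_mul] using hB.matrixElements_mul_right u 1 i j

theorem IsEigensystem.isHermitian (hA : IsEigensystem A u a) : A.IsHermitian := by
  classical
  refine matrixElements_injective (u := u) (v := u) ?_
  rw [← matrixElements_conjTranspose, hA.matrixElements_self,
    Matrix.diagonal_conjTranspose]
  congr 1
  ext j
  simp

theorem IsEigensystem.eigenvalue_eq_of_matrixElements_ne_zero [DecidableEq n]
    (hA : IsEigensystem A u a) (hA' : IsEigensystem A v b) {i j : n}
    (hij : matrixElements u v 1 i j ≠ 0) : a i = b j := by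
  have h := (hA.matrixElements_left i j).symm.trans (hA'.matrixElements_right i j)
  rw [mul_comm] at h
  exact_mod_cast mul_left_cancel₀ hij h

theorem IsEigensystem.sum_comp_eq (hA : IsEigensystem A u a) (hA' : IsEigensystem A v b)
    (f : ℝ → ℝ) : ∑ i, f (a i) = ∑ j, f (b j) := by
  classical
  calc ∑ i, f (a i) = ∑ i, ∑ j, f (a i) * ‖matrixElements u v 1 i j‖ ^ 2 := by
        simp only [← Finset.mul_sum, sum_norm_sq_matrixElements_one_right, mul_one]
    _ = ∑ i, ∑ j, f (b j) * ‖matrixElements u v 1 i j‖ ^ 2 := by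
        refine Finset.sum_congr rfl fun i _ => Finset.sum_congr rfl fun j _ => ?_
        by_cases hij : matrixElements u v 1 i j = 0
        · simp [hij]
        · rw [hA.eigenvalue_eq_of_matrixElements_ne_zero hA' hij]
    _ = ∑ j, f (b j) := by
        rw [Finset.sum_comm]
        simp only [← Finset.mul_sum, sum_norm_sq_matrixElements_one_left, mul_one]

theorem IsEigensystem.sum_eq_trace (hA : IsEigensystem A u a) : ∑ j, a j = A.trace.re := by
  classical
  rw [← trace_matrixElements (u := u), hA.matrixElements_self]
  simp [Matrix.trace_diagonal]

theorem IsEigensystem.nonneg (hA : IsEigensystem A u a) (hpos : A.PosSemidef) (j : n) :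
    0 ≤ a j := by
  classical
  have h := hpos.re_dotProduct_nonneg (u j).ofLp
  rw [← matrixElements_apply, hA.matrixElements_self, Matrix.diagonal_apply_eq] at h
  exact h

theorem IsEigensystem.mem_Icc (hA : IsEigensystem A u a) (hpos : A.PosSemidef)
    (htrace : A.trace = 1) (j : n) : a j ∈ Icc (0 : ℝ) 1 := by
  refine ⟨hA.nonneg hpos j, ?_⟩
  calc a j ≤ ∑ i, a i := Finset.single_le_sum (fun i _ => hA.nonneg hpos i) (Finset.mem_univ j)
    _ = 1 := by rw [hA.sum_eq_trace, htrace, Complex.one_re]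

theorem IsEigensystem.prob_basisMeasurement_self (hA : IsEigensystem A u a) (j : n) :
    prob A (basisMeasurement u j) = a j := by
  classical
  rw [prob_basisMeasurement, hA.matrixElements_self, Matrix.diagonal_apply_eq, Complex.ofReal_re]

theorem IsEigensystem.prob_basisMeasurement_eq_sum [DecidableEq n] (hA : IsEigensystem A u a)
    (v : OrthonormalBasis n ℂ (EuclideanSpace ℂ n)) (j : n) :
    prob A (basisMeasurement v j) = ∑ i, a i * ‖matrixElements u v 1 i j‖ ^ 2 := by
  have hconj : ∀ i, matrixElements v u 1 j i = star (matrixElements u v 1 i j) := fun i => by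
    rw [← Matrix.conjTranspose_apply, matrixElements_conjTranspose, Matrix.conjTranspose_one]
  rw [prob_basisMeasurement, ← Matrix.one_mul A, matrixElements_mul v u v, Matrix.mul_apply,
    Complex.re_sum]
  refine Finset.sum_congr rfl fun i _ => ?_
  rw [hA.matrixElements_left, hconj, mul_left_comm, Complex.star_def, Complex.conj_mul']
  norm_cast

end Eigensystem

section Lowering

variable {n : Type*} [Fintype n] {ρ A B : Matrix n n ℂ}

theorem mulVec_eq_zero_of_add_mulVec_eq_zero (hA : A.PosSemidef) (hB : B.PosSemidef) {x : n → ℂ}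
    (h : (A + B) *ᵥ x = 0) : A *ᵥ x = 0 := by
  refine (hA.dotProduct_mulVec_zero_iff x).1 (le_antisymm ?_ (hA.dotProduct_mulVec_nonneg x))
  calc star x ⬝ᵥ A *ᵥ x ≤ star x ⬝ᵥ A *ᵥ x + star x ⬝ᵥ B *ᵥ x :=
        le_add_of_nonneg_right (hB.dotProduct_mulVec_nonneg x)
    _ = 0 := by rw [← dotProduct_add, ← Matrix.add_mulVec, h, dotProduct_zero]

variable [DecidableEq n]

/- The terms with `λ_j + λ_k = 0` are absorbed by the convention `2 / 0 = 0`. -/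
theorem matrixElements_lowering (hρ : ρ.IsHermitian) (A : Matrix n n ℂ) (i j : n) :
    matrixElements hρ.eigenvectorBasis hρ.eigenvectorBasis (lowering hρ A) i j =
      ((2 / (hρ.eigenvalues i + hρ.eigenvalues j) : ℝ) : ℂ) *
        matrixElements hρ.eigenvectorBasis hρ.eigenvectorBasis A i j := by
  let W : Matrix n n ℂ := Matrix.of fun i j =>
    ((2 / (hρ.eigenvalues i + hρ.eigenvalues j) : ℝ) : ℂ) *
      matrixElements hρ.eigenvectorBasis hρ.eigenvectorBasis A i j
  have hW : lowering hρ A =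
      ketMatrix hρ.eigenvectorBasis * W * (ketMatrix hρ.eigenvectorBasis)ᴴ := by
    ext k l
    rw [Matrix.mul_assoc]
    simp only [lowering, Matrix.sum_apply, Matrix.mul_apply, Finset.mul_sum]
    refine Finset.sum_congr rfl fun i _ => Finset.sum_congr rfl fun j _ => ?_
    simp only [W, Matrix.of_apply, matrixElements_apply, ketMatrix, Matrix.conjTranspose_apply]
    split_ifs with hzero
    · simp [hzero]
    · simp only [Matrix.smul_apply, Matrix.vecMulVec_apply, smul_eq_mul, Pi.star_apply]
      push_cast
      ring
  rw [hW, matrixElements_ketMatrix_mul]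
  rfl

theorem lowering_isHermitian (hρ : ρ.IsHermitian) (hA : A.IsHermitian) :
    (lowering hρ A).IsHermitian := by
  refine matrixElements_injective (u := hρ.eigenvectorBasis) (v := hρ.eigenvectorBasis) ?_
  ext i j
  rw [← matrixElements_conjTranspose, Matrix.conjTranspose_apply, matrixElements_lowering,
    matrixElements_lowering, star_mul', Complex.star_def, Complex.conj_ofReal, ← Complex.star_def,
    ← Matrix.conjTranspose_apply, matrixElements_conjTranspose, hA.eq, add_comm]

theorem mul_lowering_add_lowering_mul (hρ : ρ.PosSemidef)
    (hker : ∀ x, ρ *ᵥ x = 0 → A *ᵥ x = 0) :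
    ρ * lowering hρ.isHermitian A + lowering hρ.isHermitian A * ρ = (2 : ℂ) • A := by
  have hsys := isEigensystem_eigenvectorBasis hρ.isHermitian
  refine matrixElements_injective (u := hρ.isHermitian.eigenvectorBasis)
    (v := hρ.isHermitian.eigenvectorBasis) ?_
  ext i j
  rw [two_smul, matrixElements_add, matrixElements_add, Matrix.add_apply, Matrix.add_apply,
    hsys.matrixElements_mul_left, hsys.matrixElements_mul_right, matrixElements_lowering]
  by_cases hzero : hρ.isHermitian.eigenvalues i + hρ.isHermitian.eigenvalues j = 0
  · have hj : hρ.isHermitian.eigenvalues j = 0 :=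
      ((add_eq_zero_iff_of_nonneg (hsys.nonneg hρ i) (hsys.nonneg hρ j)).1 hzero).2
    have hAj : A *ᵥ (hρ.isHermitian.eigenvectorBasis j).ofLp = 0 := by
      refine hker _ ?_
      rw [hsys j, hj, Complex.ofReal_zero, zero_smul]
    simp only [matrixElements_apply, hAj, dotProduct_zero, mul_zero, zero_mul]
  · have hne : (hρ.isHermitian.eigenvalues i : ℂ) + hρ.isHermitian.eigenvalues j ≠ 0 := by
      exact_mod_cast hzero
    push_cast
    field_simp
    ring

end Lowering

section Channel

variable {n : Type*} [Fintype n] (ρ₀ ρ₁ : DensityOperator n) {t : ℝ} {x : n → ℂ}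

theorem diff_isHermitian : (diff ρ₀ ρ₁).IsHermitian :=
  ρ₁.posSemidef.isHermitian.sub ρ₀.posSemidef.isHermitian

theorem mean_posSemidef (ht : t ∈ Icc (0 : ℝ) 1) : (mean ρ₀ ρ₁ t).PosSemidef :=
  (ρ₀.posSemidef.smul (Complex.zero_le_real.2 (sub_nonneg.2 ht.2))).add
    (ρ₁.posSemidef.smul (Complex.zero_le_real.2 ht.1))

theorem trace_mean (t : ℝ) : (mean ρ₀ ρ₁ t).trace = 1 := by
  simp [mean, ρ₀.trace_eq_one, ρ₁.trace_eq_one]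

theorem mean_zero : mean ρ₀ ρ₁ 0 = ρ₀.op := by
  simp [mean]

theorem mean_one : mean ρ₀ ρ₁ 1 = ρ₁.op := by
  simp [mean]

theorem mean_sub_mean (s t : ℝ) :
    mean ρ₀ ρ₁ s - mean ρ₀ ρ₁ t = ((s - t : ℝ) : ℂ) • diff ρ₀ ρ₁ := by
  simp only [mean, diff]
  push_cast
  module

variable {ρ₀ ρ₁}

theorem op_mulVec_eq_zero_of_mean (ht : t ∈ Ioo (0 : ℝ) 1) (h : mean ρ₀ ρ₁ t *ᵥ x = 0) :
    ρ₀.op *ᵥ x = 0 ∧ ρ₁.op *ᵥ x = 0 := by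
  have h₀ : (0 : ℝ) < 1 - t := sub_pos.2 ht.2
  have hpos₀ := ρ₀.posSemidef.smul (Complex.zero_le_real.2 h₀.le)
  have hpos₁ := ρ₁.posSemidef.smul (Complex.zero_le_real.2 ht.1.le)
  constructor
  · have := mulVec_eq_zero_of_add_mulVec_eq_zero hpos₀ hpos₁ h
    rw [Matrix.smul_mulVec] at this
    exact (smul_eq_zero.1 this).resolve_left (Complex.ofReal_ne_zero.2 h₀.ne')
  · have := mulVec_eq_zero_of_add_mulVec_eq_zero hpos₁ hpos₀ (x := x) (by rwa [add_comm])
    rw [Matrix.smul_mulVec] at this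
    exact (smul_eq_zero.1 this).resolve_left (Complex.ofReal_ne_zero.2 ht.1.ne')

theorem mean_mulVec_eq_zero (ht : t ∈ Ioo (0 : ℝ) 1) (h : mean ρ₀ ρ₁ t *ᵥ x = 0) (s : ℝ) :
    mean ρ₀ ρ₁ s *ᵥ x = 0 := by
  obtain ⟨h₀, h₁⟩ := op_mulVec_eq_zero_of_mean ht h
  rw [mean, Matrix.add_mulVec, Matrix.smul_mulVec, Matrix.smul_mulVec, h₀, h₁, smul_zero,
    smul_zero, add_zero]

theorem diff_mulVec_eq_zero (ht : t ∈ Ioo (0 : ℝ) 1) (h : mean ρ₀ ρ₁ t *ᵥ x = 0) :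
    diff ρ₀ ρ₁ *ᵥ x = 0 := by
  obtain ⟨h₀, h₁⟩ := op_mulVec_eq_zero_of_mean ht h
  rw [diff, Matrix.sub_mulVec, h₀, h₁, sub_zero]

variable [DecidableEq n]

theorem loweredDiff_isHermitian (ρ₀ ρ₁ : DensityOperator n) (t : ℝ) :
    (loweredDiff ρ₀ ρ₁ t).IsHermitian :=
  lowering_isHermitian _ (diff_isHermitian ρ₀ ρ₁)

theorem mean_mul_loweredDiff_add (ht : t ∈ Ioo (0 : ℝ) 1) :
    mean ρ₀ ρ₁ t * loweredDiff ρ₀ ρ₁ t + loweredDiff ρ₀ ρ₁ t * mean ρ₀ ρ₁ t =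
      (2 : ℂ) • diff ρ₀ ρ₁ :=
  mul_lowering_add_lowering_mul (mean_posSemidef ρ₀ ρ₁ (Ioo_subset_Icc_self ht))
    fun _ => diff_mulVec_eq_zero ht

end Channel

section FisherInformation

variable {n ι : Type*} [Fintype n] [Fintype ι] {ρ A L F Y : Matrix n n ℂ}

/-- `L` is a symmetric logarithmic derivative of `ρ` in the direction `A`: a Hermitian solution of
`(ρ L + L ρ) / 2 = A`. -/
structure IsSymmLogDeriv (ρ A L : Matrix n n ℂ) : Prop where
  isHermitian : L.IsHermitian
  mul_add_mul : ρ * L + L * ρ = (2 : ℂ) • A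

/-- The Fisher information of the outcome distribution of the measurement `E` in the state `ρ`, for
the derivative `A` of the state. Outcomes of probability zero contribute `x / 0 = 0`. -/
noncomputable def fisherInfo (ρ A : Matrix n n ℂ) (E : ι → Matrix n n ℂ) : ℝ :=
  ∑ b, prob A (E b) ^ 2 / prob ρ (E b)

theorem IsSymmLogDeriv.prob_mul (hL : IsSymmLogDeriv ρ A L) (hρ : ρ.IsHermitian)
    (hY : Y.IsHermitian) : prob (ρ * L) Y = prob A Y := by
  have h : prob (ρ * L + L * ρ) Y = prob (((2 : ℝ) : ℂ) • A) Y := by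
    rw [hL.mul_add_mul, Complex.ofReal_ofNat]
  rw [prob_add_left, prob_smul_left, ← prob_mul_swap hρ hL.isHermitian hY] at h
  linarith

theorem IsSymmLogDeriv.prob_mul_self (hL : IsSymmLogDeriv ρ A L) (hρ : ρ.IsHermitian) :
    prob ρ (L * L) = prob A L := by
  rw [← hL.prob_mul hρ hL.isHermitian, prob, prob, Matrix.mul_assoc]

theorem IsSymmLogDeriv.two_mul_prob_sub_le (hL : IsSymmLogDeriv ρ A L) (hρ : ρ.PosSemidef)
    (hY : Y.IsHermitian) : 2 * prob A Y - prob ρ (Y * Y) ≤ prob A L := by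
  have hpos : 0 ≤ prob ρ ((Y - L) * (Y - L)) := by
    refine prob_nonneg hρ ?_
    simpa only [(hY.sub hL.isHermitian).eq] using Matrix.posSemidef_conjTranspose_mul_self (Y - L)
  have hexpand : prob ρ ((Y - L) * (Y - L)) =
      prob ρ (Y * Y) - prob (ρ * Y) L - prob (ρ * L) Y + prob ρ (L * L) := by
    simp only [prob, Matrix.mul_sub, Matrix.sub_mul, Matrix.trace_sub, Complex.sub_re,
      Matrix.mul_assoc]
    ring
  have hYL : prob (ρ * Y) L = prob A Y := by
    rw [prob_mul_swap hρ.isHermitian hY hL.isHermitian, prob_mul_left_comm,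
      ← hL.prob_mul hρ.isHermitian hY, prob, prob, Matrix.mul_assoc]
  rw [hexpand, hYL, hL.prob_mul hρ.isHermitian hY, hL.prob_mul_self hρ.isHermitian] at hpos
  linarith

theorem prob_mul_mul_nonneg (hρ : ρ.PosSemidef) (hY : Y.IsHermitian) (hF : F.PosSemidef) :
    0 ≤ prob (Y * ρ * Y) F := by
  refine prob_nonneg ?_ hF
  simpa only [hY.eq] using hρ.mul_mul_conjTranspose_same Y

/- Cauchy-Schwarz: `tr ((L - μ) ρ (L - μ) F)` is nonnegative for `μ = tr (A F) / tr (ρ F)`. -/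
theorem IsSymmLogDeriv.sq_prob_div_le (hL : IsSymmLogDeriv ρ A L) (hρ : ρ.PosSemidef)
    (hF : F.PosSemidef) : prob A F ^ 2 / prob ρ F ≤ prob (L * ρ * L) F := by
  classical
  let μ : ℝ := prob A F / prob ρ F
  have hμ : ((μ : ℂ) • (1 : Matrix n n ℂ)).IsHermitian := by
    simp [Matrix.IsHermitian, Matrix.conjTranspose_smul]
  have hpos := prob_mul_mul_nonneg hρ (hL.isHermitian.sub hμ) hF
  have hexpand : (L - (μ : ℂ) • 1) * ρ * (L - (μ : ℂ) • 1) =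
      L * ρ * L - (μ : ℂ) • (L * ρ) - (μ : ℂ) • (ρ * L) + (μ : ℂ) • ((μ : ℂ) • ρ) := by
    simp only [Matrix.sub_mul, Matrix.mul_sub, Matrix.smul_mul, Matrix.mul_smul, Matrix.one_mul,
      Matrix.mul_one, smul_sub]
    abel
  rw [hexpand, prob_add_left, prob_sub_left, prob_sub_left, prob_smul_left, prob_smul_left,
    prob_smul_left, prob_smul_left, ← prob_mul_swap hρ.isHermitian hL.isHermitian hF.isHermitian,
    hL.prob_mul hρ.isHermitian hF.isHermitian] at hpos
  have hsq : prob A F ^ 2 / prob ρ F = 2 * (μ * prob A F) - μ * (μ * prob ρ F) := by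
    by_cases hzero : prob ρ F = 0
    · simp [μ, hzero]
    · simp only [μ]
      field_simp
      ring
  linarith

variable {E : ι → Matrix n n ℂ}

theorem IsPOVM.sum_prob [DecidableEq n] (hE : IsPOVM E) (A : Matrix n n ℂ) :
    ∑ b, prob A (E b) = A.trace.re := by
  rw [← prob_sum_right, hE.sum_eq_one, prob_one_right]

theorem IsSymmLogDeriv.fisherInfo_le [DecidableEq n] (hL : IsSymmLogDeriv ρ A L) (hρ : ρ.PosSemidef)
    (hE : IsPOVM E) : fisherInfo ρ A E ≤ prob A L := by
  calc fisherInfo ρ A E ≤ ∑ b, prob (L * ρ * L) (E b) :=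
        Finset.sum_le_sum fun b _ => hL.sq_prob_div_le hρ (hE.posSemidef b)
    _ = prob ρ (L * L) := by
        rw [hE.sum_prob, Matrix.mul_assoc, Matrix.trace_mul_comm, Matrix.mul_assoc, prob]
    _ = prob A L := hL.prob_mul_self hρ.isHermitian

theorem isPOVM_basisMeasurement [DecidableEq n] (v : OrthonormalBasis n ℂ (EuclideanSpace ℂ n)) :
    IsPOVM (basisMeasurement v) where
  posSemidef b := Matrix.posSemidef_vecMulVec_self_star _
  sum_eq_one := by
    rw [← ketMatrix_mul_conjTranspose v]
    ext i j
    simp only [Matrix.sum_apply, basisMeasurement, Matrix.vecMulVec_apply, Matrix.mul_apply,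
      ketMatrix, Matrix.of_apply, Matrix.conjTranspose_apply, Pi.star_apply]

variable {v : OrthonormalBasis n ℂ (EuclideanSpace ℂ n)} {b : n} {μ : ℂ}

theorem prob_mul_basisMeasurement (hA : A.IsHermitian)
    (hμ : L *ᵥ (v b).ofLp = μ • (v b).ofLp) :
    prob A (L * basisMeasurement v b) = μ.re * prob A (basisMeasurement v b) := by
  classical
  have hb := ((isPOVM_basisMeasurement v).posSemidef b).isHermitian
  have hproj : L * basisMeasurement v b = μ • basisMeasurement v b := by
    rw [basisMeasurement, Matrix.mul_vecMulVec, hμ, Matrix.smul_vecMulVec]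
  rw [hproj, prob, Matrix.mul_smul, Matrix.trace_smul, smul_eq_mul, ← ofReal_prob hA hb,
    Complex.re_mul_ofReal]

/- In an eigenbasis of `L` with eigenvalues `μ_b` the derivative `tr (A E_b)` is
`μ_b tr (ρ E_b)`. -/
theorem IsSymmLogDeriv.fisherInfo_basisMeasurement (hL : IsSymmLogDeriv ρ A L)
    (hρ : ρ.IsHermitian) (hA : A.IsHermitian) (hv : IsEigenbasis v L) :
    fisherInfo ρ A (basisMeasurement v) = prob A L := by
  classical
  choose μ hμ using hv
  have hprob : ∀ b, prob A (basisMeasurement v b) =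
      (μ b).re * prob ρ (basisMeasurement v b) := fun b => by
    rw [← prob_mul_basisMeasurement hρ (hμ b),
      ← hL.prob_mul hρ ((isPOVM_basisMeasurement v).posSemidef b).isHermitian, prob, prob,
      Matrix.mul_assoc]
  calc fisherInfo ρ A (basisMeasurement v)
      = ∑ b, (μ b).re * prob A (basisMeasurement v b) := by
        refine Finset.sum_congr rfl fun b _ => ?_
        rw [hprob]
        by_cases hzero : prob ρ (basisMeasurement v b) = 0
        · simp [hzero]
        · field_simp
    _ = ∑ b, prob A (L * basisMeasurement v b) := by
        simp only [fun b => prob_mul_basisMeasurement hA (hμ b)]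
    _ = prob A L := by
        rw [← prob_sum_right, ← Finset.mul_sum, (isPOVM_basisMeasurement v).sum_eq_one,
          Matrix.mul_one]

end FisherInformation

section OutcomeInformation

variable {p q t : ℝ}

/-- The contribution to the mutual information `J(t)` of an outcome that has the probability `p`
under `ρ₀` and `q` under `ρ₁`. -/
noncomputable def outcomeInfo (p q t : ℝ) : ℝ :=
  Real.negMulLog ((1 - t) * p + t * q) - (1 - t) * Real.negMulLog p - t * Real.negMulLog q

@[fun_prop]
theorem continuous_outcomeInfo {X : Type*} [TopologicalSpace X] {p q t : X → ℝ}
    (hp : Continuous p) (hq : Continuous q) (ht : Continuous t) :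
    Continuous fun x => outcomeInfo (p x) (q x) (t x) := by
  have := Real.continuous_negMulLog
  unfold outcomeInfo
  fun_prop

theorem outcomeInfo_mul (c p q t : ℝ) : outcomeInfo (c * p) (c * q) t = c * outcomeInfo p q t := by
  have h : (1 - t) * (c * p) + t * (c * q) = c * ((1 - t) * p + t * q) := by ring
  rw [outcomeInfo, outcomeInfo, h, Real.negMulLog_mul, Real.negMulLog_mul, Real.negMulLog_mul]
  ring

theorem outcomeInfo_zero_zero : outcomeInfo 0 0 = fun _ => 0 := by
  ext t
  simp [outcomeInfo]

theorem mixture_pos_of_ne_zero (hp : 0 ≤ p) (hq : 0 ≤ q) (ht : t ∈ Ioo (0 : ℝ) 1)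
    (h : ¬ (p = 0 ∧ q = 0)) : 0 < (1 - t) * p + t * q := by
  have ht' : 0 < 1 - t := sub_pos.2 ht.2
  have ht₀ := ht.1
  by_cases hp₀ : p = 0
  · have : 0 < q := hq.lt_of_ne' fun hq₀ => h ⟨hp₀, hq₀⟩
    positivity
  · have : 0 < p := hp.lt_of_ne' hp₀
    positivity

theorem hasSecondDerivAt_outcomeInfo (hp : 0 ≤ p) (hq : 0 ≤ q) (ht : t ∈ Ioo (0 : ℝ) 1) :
    HasSecondDerivAt (outcomeInfo p q) (-((q - p) ^ 2 / ((1 - t) * p + t * q))) t := by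
  have hmix : ∀ s, HasDerivAt (fun s : ℝ => (1 - s) * p + s * q) (q - p) s := fun s =>
    ((((hasDerivAt_id' s).const_sub 1).mul_const p).fun_add
      ((hasDerivAt_id' s).mul_const q)).congr_deriv (by ring)
  by_cases hzero : p = 0 ∧ q = 0
  · obtain ⟨rfl, rfl⟩ := hzero
    convert hasSecondDerivAt_cubic 0 0 0 0 t using 1
    · simp [outcomeInfo_zero_zero]
    · simp
  refine ⟨fun s => (q - p) * (-Real.log ((1 - s) * p + s * q) - 1) + Real.negMulLog p
    - Real.negMulLog q, ?_, ?_⟩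
  · filter_upwards [Ioo_mem_nhds ht.1 ht.2] with s hs
    have hlog := (Real.hasDerivAt_negMulLog (mixture_pos_of_ne_zero hp hq hs hzero).ne').comp s
      (hmix s)
    exact ((hlog.sub (((hasDerivAt_id' s).const_sub 1).mul_const (Real.negMulLog p))).sub
      ((hasDerivAt_id' s).mul_const (Real.negMulLog q))).congr_deriv (by ring)
  · have hlog := (hmix t).log (mixture_pos_of_ne_zero hp hq ht hzero).ne'
    exact ((((hlog.neg.sub_const 1).const_mul (q - p)).add_const _).sub_const _).congr_deriv
      (by ring)

theorem contDiffAt_outcomeInfo (hp : 0 ≤ p) (hq : 0 ≤ q) (ht : t ∈ Ioo (0 : ℝ) 1) :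
    ContDiffAt ℝ 2 (outcomeInfo p q) t := by
  by_cases hzero : p = 0 ∧ q = 0
  · obtain ⟨rfl, rfl⟩ := hzero
    rw [outcomeInfo_zero_zero]
    exact contDiffAt_const
  · have hmix : ContDiffAt ℝ 2 (fun s : ℝ => (1 - s) * p + s * q) t := by fun_prop
    have hlog : ContDiffAt ℝ 2 (fun s : ℝ => Real.negMulLog ((1 - s) * p + s * q)) t :=
      hmix.neg.mul (hmix.log (mixture_pos_of_ne_zero hp hq ht hzero).ne')
    unfold outcomeInfo
    fun_prop

end OutcomeInformation

section MutualInformation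

theorem IsPOVM.comp_equiv {n ι κ : Type*} [DecidableEq n] [Fintype ι] [Fintype κ]
    {E : ι → Matrix n n ℂ} (hE : IsPOVM E) (e : κ ≃ ι) : IsPOVM (E ∘ e) where
  posSemidef b := hE.posSemidef (e b)
  sum_eq_one := (e.sum_comp E).trans hE.sum_eq_one

variable {n ι : Type*} [Fintype n] [Fintype ι] {ρ₀ ρ₁ : DensityOperator n}
  {E : ι → Matrix n n ℂ} {t : ℝ}

theorem prob_mean (ρ₀ ρ₁ : DensityOperator n) (F : Matrix n n ℂ) (t : ℝ) :
    prob (mean ρ₀ ρ₁ t) F = (1 - t) * prob ρ₀.op F + t * prob ρ₁.op F := by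
  rw [mean, prob_add_left, prob_smul_left, prob_smul_left]

theorem prob_diff (ρ₀ ρ₁ : DensityOperator n) (F : Matrix n n ℂ) :
    prob (diff ρ₀ ρ₁) F = prob ρ₁.op F - prob ρ₀.op F :=
  prob_sub_left _ _ _

theorem mutualInfo_eq_sum_outcomeInfo (ρ₀ ρ₁ : DensityOperator n) (E : ι → Matrix n n ℂ) :
    mutualInfo ρ₀ ρ₁ E = fun t => ∑ b, outcomeInfo (prob ρ₀.op (E b)) (prob ρ₁.op (E b)) t := by
  ext t
  simp only [mutualInfo, shannon, prob_mean, outcomeInfo, Finset.sum_sub_distrib, Finset.mul_sum]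

theorem mutualInfo_comp_equiv {κ : Type*} [Fintype κ] (e : κ ≃ ι) (E : ι → Matrix n n ℂ) :
    mutualInfo ρ₀ ρ₁ (E ∘ e) = mutualInfo ρ₀ ρ₁ E := by
  rw [mutualInfo_eq_sum_outcomeInfo, mutualInfo_eq_sum_outcomeInfo]
  ext t
  exact e.sum_comp fun b => outcomeInfo (prob ρ₀.op (E b)) (prob ρ₁.op (E b)) t

theorem mutualInfo_zero (ρ₀ ρ₁ : DensityOperator n) (E : ι → Matrix n n ℂ) :
    mutualInfo ρ₀ ρ₁ E 0 = 0 := by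
  simp [mutualInfo, mean_zero]

theorem mutualInfo_one (ρ₀ ρ₁ : DensityOperator n) (E : ι → Matrix n n ℂ) :
    mutualInfo ρ₀ ρ₁ E 1 = 0 := by
  simp [mutualInfo, mean_one]

theorem continuous_mutualInfo (ρ₀ ρ₁ : DensityOperator n) (E : ι → Matrix n n ℂ) :
    Continuous (mutualInfo ρ₀ ρ₁ E) := by
  rw [mutualInfo_eq_sum_outcomeInfo]
  fun_prop

variable [DecidableEq n]

theorem IsPOVM.mutualInfo_mem (hE : IsPOVM E) (ρ₀ ρ₁ : DensityOperator n) (t : ℝ) :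
    mutualInfo ρ₀ ρ₁ E t ∈ mutualInfoValues ρ₀ ρ₁ t :=
  ⟨_, E ∘ (Fintype.equivFin ι).symm, hE.comp_equiv _, congrFun (mutualInfo_comp_equiv _ E) t⟩

theorem IsPOVM.iteratedDeriv_mem (hE : IsPOVM E) (ρ₀ ρ₁ : DensityOperator n) (t : ℝ) :
    iteratedDeriv 2 (mutualInfo ρ₀ ρ₁ E) t ∈ mutualInfoSecondDerivValues ρ₀ ρ₁ t :=
  ⟨_, E ∘ (Fintype.equivFin ι).symm, hE.comp_equiv _, by rw [mutualInfo_comp_equiv]⟩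

theorem contDiffAt_mutualInfo (hE : IsPOVM E) (ht : t ∈ Ioo (0 : ℝ) 1) :
    ContDiffAt ℝ 2 (mutualInfo ρ₀ ρ₁ E) t := by
  rw [mutualInfo_eq_sum_outcomeInfo]
  exact ContDiffAt.sum fun b _ => contDiffAt_outcomeInfo
    (prob_nonneg ρ₀.posSemidef (hE.posSemidef b)) (prob_nonneg ρ₁.posSemidef (hE.posSemidef b)) ht

theorem hasSecondDerivAt_mutualInfo (hE : IsPOVM E) (ht : t ∈ Ioo (0 : ℝ) 1) :
    HasSecondDerivAt (mutualInfo ρ₀ ρ₁ E)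
      (-fisherInfo (mean ρ₀ ρ₁ t) (diff ρ₀ ρ₁) E) t := by
  rw [mutualInfo_eq_sum_outcomeInfo, fisherInfo, ← Finset.sum_neg_distrib]
  simp only [prob_diff, prob_mean]
  exact HasSecondDerivAt.sum _ fun b _ => hasSecondDerivAt_outcomeInfo
    (prob_nonneg ρ₀.posSemidef (hE.posSemidef b)) (prob_nonneg ρ₁.posSemidef (hE.posSemidef b)) ht

theorem isSymmLogDeriv_loweredDiff (ht : t ∈ Ioo (0 : ℝ) 1) :
    IsSymmLogDeriv (mean ρ₀ ρ₁ t) (diff ρ₀ ρ₁) (loweredDiff ρ₀ ρ₁ t) :=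
  ⟨loweredDiff_isHermitian ρ₀ ρ₁ t, mean_mul_loweredDiff_add ht⟩

theorem curvature_eq_neg_prob (ρ₀ ρ₁ : DensityOperator n) (t : ℝ) :
    curvature ρ₀ ρ₁ t = -prob (diff ρ₀ ρ₁) (loweredDiff ρ₀ ρ₁ t) := rfl

theorem curvature_le_neg_fisherInfo (hE : IsPOVM E) (ht : t ∈ Ioo (0 : ℝ) 1) :
    curvature ρ₀ ρ₁ t ≤ -fisherInfo (mean ρ₀ ρ₁ t) (diff ρ₀ ρ₁) E :=
  neg_le_neg ((isSymmLogDeriv_loweredDiff ht).fisherInfo_le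
    (mean_posSemidef ρ₀ ρ₁ (Ioo_subset_Icc_self ht)) hE)

theorem neg_fisherInfo_eigenbasis {v : OrthonormalBasis n ℂ (EuclideanSpace ℂ n)}
    (hv : IsEigenbasis v (loweredDiff ρ₀ ρ₁ t)) (ht : t ∈ Ioo (0 : ℝ) 1) :
    -fisherInfo (mean ρ₀ ρ₁ t) (diff ρ₀ ρ₁) (basisMeasurement v) = curvature ρ₀ ρ₁ t :=
  congrArg Neg.neg ((isSymmLogDeriv_loweredDiff ht).fisherInfo_basisMeasurement
    (mean_isHermitian ρ₀ ρ₁ t) (diff_isHermitian ρ₀ ρ₁) hv)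

theorem iteratedDeriv_two_mutualInfo_eigenbasis {v : OrthonormalBasis n ℂ (EuclideanSpace ℂ n)}
    (hv : IsEigenbasis v (loweredDiff ρ₀ ρ₁ t)) (ht : t ∈ Ioo (0 : ℝ) 1) :
    iteratedDeriv 2 (mutualInfo ρ₀ ρ₁ (basisMeasurement v)) t = curvature ρ₀ ρ₁ t := by
  rw [(hasSecondDerivAt_mutualInfo (isPOVM_basisMeasurement v) ht).iteratedDeriv_two,
    neg_fisherInfo_eigenbasis hv ht]

theorem isEigenbasis_eigenvectorBasis {A : Matrix n n ℂ} (hA : A.IsHermitian) :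
    IsEigenbasis hA.eigenvectorBasis A := fun j =>
  ⟨_, isEigensystem_eigenvectorBasis hA j⟩

theorem isLeast_curvature (ht : t ∈ Ioo (0 : ℝ) 1) :
    IsLeast (mutualInfoSecondDerivValues ρ₀ ρ₁ t) (curvature ρ₀ ρ₁ t) := by
  constructor
  · have hv := isEigenbasis_eigenvectorBasis (loweredDiff_isHermitian ρ₀ ρ₁ t)
    rw [← iteratedDeriv_two_mutualInfo_eigenbasis hv ht]
    exact (isPOVM_basisMeasurement _).iteratedDeriv_mem ρ₀ ρ₁ t
  · rintro _ ⟨N, E, hE, rfl⟩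
    rw [(hasSecondDerivAt_mutualInfo hE ht).iteratedDeriv_two]
    exact curvature_le_neg_fisherInfo hE ht

end MutualInformation

section Curvature

variable {n ι : Type*} [Fintype n] [DecidableEq n] [Fintype ι] {ρ₀ ρ₁ : DensityOperator n}
  {E : ι → Matrix n n ℂ} {t : ℝ}

theorem sq_sub_div_mixture_le {p q : ℝ} (hp : 0 ≤ p) (hq : 0 ≤ q) (ht : t ∈ Ioo (0 : ℝ) 1) :
    (q - p) ^ 2 / ((1 - t) * p + t * q) ≤ (t * p + (1 - t) * q) / (t * (1 - t)) := by
  have ht₀ := ht.1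
  have ht₁ : 0 < 1 - t := sub_pos.2 ht.2
  by_cases hzero : p = 0 ∧ q = 0
  · obtain ⟨rfl, rfl⟩ := hzero
    simp
  rw [div_le_div_iff₀ (mixture_pos_of_ne_zero hp hq ht hzero) (by positivity)]
  have hgap : 0 ≤ p * q := mul_nonneg hp hq
  linarith

theorem fisherInfo_le_inv (hE : IsPOVM E) (ht : t ∈ Ioo (0 : ℝ) 1) :
    fisherInfo (mean ρ₀ ρ₁ t) (diff ρ₀ ρ₁) E ≤ 1 / (t * (1 - t)) := by
  calc fisherInfo (mean ρ₀ ρ₁ t) (diff ρ₀ ρ₁) E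
      ≤ ∑ b, (t * prob ρ₀.op (E b) + (1 - t) * prob ρ₁.op (E b)) / (t * (1 - t)) := by
        simp only [fisherInfo, prob_diff, prob_mean]
        exact Finset.sum_le_sum fun b _ => sq_sub_div_mixture_le
          (prob_nonneg ρ₀.posSemidef (hE.posSemidef b))
          (prob_nonneg ρ₁.posSemidef (hE.posSemidef b)) ht
    _ = 1 / (t * (1 - t)) := by
        rw [← Finset.sum_div, Finset.sum_add_distrib, ← Finset.mul_sum, ← Finset.mul_sum,
          hE.sum_prob, hE.sum_prob, ρ₀.trace_eq_one, ρ₁.trace_eq_one, Complex.one_re]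
        ring

theorem exists_fisherInfo_eq_neg_curvature (ρ₀ ρ₁ : DensityOperator n) (ht : t ∈ Ioo (0 : ℝ) 1) :
    ∃ E : n → Matrix n n ℂ, IsPOVM E ∧
      fisherInfo (mean ρ₀ ρ₁ t) (diff ρ₀ ρ₁) E = -curvature ρ₀ ρ₁ t :=
  ⟨_, isPOVM_basisMeasurement _, neg_eq_iff_eq_neg.1 (neg_fisherInfo_eigenbasis
    (isEigenbasis_eigenvectorBasis (loweredDiff_isHermitian ρ₀ ρ₁ t)) ht)⟩

theorem norm_curvature_le (ρ₀ ρ₁ : DensityOperator n) (ht : t ∈ Ioo (0 : ℝ) 1) :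
    ‖curvature ρ₀ ρ₁ t‖ ≤ 1 / (t * (1 - t)) := by
  obtain ⟨E, hE, hfisher⟩ := exists_fisherInfo_eq_neg_curvature ρ₀ ρ₁ ht
  have hnonneg : 0 ≤ fisherInfo (mean ρ₀ ρ₁ t) (diff ρ₀ ρ₁) E :=
    Finset.sum_nonneg fun b _ => div_nonneg (sq_nonneg _)
      (prob_nonneg (mean_posSemidef ρ₀ ρ₁ (Ioo_subset_Icc_self ht)) (hE.posSemidef b))
  rw [← norm_neg, ← hfisher, Real.norm_of_nonneg hnonneg]
  exact fisherInfo_le_inv hE ht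

/- The curvature is the minimum over the Hermitian `Y` of `tr (ρ(t) Y²) - 2 tr (Δ Y)`, which is
affine in `t`. -/
theorem concaveOn_curvature (ρ₀ ρ₁ : DensityOperator n) :
    ConcaveOn ℝ (Ioo 0 1) (curvature ρ₀ ρ₁) := by
  refine ⟨convex_Ioo 0 1, fun x hx y hy a b ha hb hab => ?_⟩
  have hz := (convex_Ioo (0 : ℝ) 1) hx hy ha hb hab
  simp only [smul_eq_mul] at hz ⊢
  let Y := loweredDiff ρ₀ ρ₁ (a * x + b * y)
  have hle : ∀ t ∈ Ioo (0 : ℝ) 1,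
      curvature ρ₀ ρ₁ t ≤ prob (mean ρ₀ ρ₁ t) (Y * Y) - 2 * prob (diff ρ₀ ρ₁) Y := fun t ht => by
    rw [curvature_eq_neg_prob]
    have := (isSymmLogDeriv_loweredDiff ht).two_mul_prob_sub_le
      (mean_posSemidef ρ₀ ρ₁ (Ioo_subset_Icc_self ht))
      (loweredDiff_isHermitian ρ₀ ρ₁ (a * x + b * y))
    linarith
  have heq : curvature ρ₀ ρ₁ (a * x + b * y) =
      prob (mean ρ₀ ρ₁ (a * x + b * y)) (Y * Y) - 2 * prob (diff ρ₀ ρ₁) Y := by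
    rw [(isSymmLogDeriv_loweredDiff hz).prob_mul_self (mean_isHermitian ρ₀ ρ₁ _),
      curvature_eq_neg_prob]
    ring
  calc a * curvature ρ₀ ρ₁ x + b * curvature ρ₀ ρ₁ y
      ≤ a * (prob (mean ρ₀ ρ₁ x) (Y * Y) - 2 * prob (diff ρ₀ ρ₁) Y) +
        b * (prob (mean ρ₀ ρ₁ y) (Y * Y) - 2 * prob (diff ρ₀ ρ₁) Y) := by
        gcongr
        exacts [hle x hx, hle y hy]
    _ = curvature ρ₀ ρ₁ (a * x + b * y) := by
        obtain rfl := eq_sub_of_add_eq' hab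
        rw [heq, prob_mean, prob_mean, prob_mean]
        ring

theorem continuousOn_curvature (ρ₀ ρ₁ : DensityOperator n) :
    ContinuousOn (curvature ρ₀ ρ₁) (Ioo 0 1) :=
  (concaveOn_curvature ρ₀ ρ₁).continuousOn isOpen_Ioo

end Curvature

section CurvatureBound

variable {n ι : Type*} [Fintype n] [DecidableEq n] [Fintype ι] {ρ₀ ρ₁ : DensityOperator n}
  {E : ι → Matrix n n ℂ} {L L' : ℝ → ℝ} {t : ℝ}

theorem exists_isCurvatureBound (ρ₀ ρ₁ : DensityOperator n) : ∃ L, IsCurvatureBound ρ₀ ρ₁ L := by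
  obtain ⟨L, L', hcont, hzero, hone, hL⟩ := exists_second_primitive
    (continuousOn_curvature ρ₀ ρ₁) fun t ht => norm_curvature_le ρ₀ ρ₁ ht
  refine ⟨L, hcont, hzero, hone, fun t ht => (hL t ht).1.differentiableAt, fun t ht => ?_⟩
  refine (hL t ht).2.congr_of_eventuallyEq ?_
  filter_upwards [Ioo_mem_nhds ht.1 ht.2] with s hs using (hL s hs).1.deriv

theorem IsCurvatureBound.hasSecondDerivAt (hL : IsCurvatureBound ρ₀ ρ₁ L)
    (ht : t ∈ Ioo (0 : ℝ) 1) : HasSecondDerivAt L (curvature ρ₀ ρ₁ t) t := by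
  refine ⟨deriv L, ?_, hL.hasDerivAt_deriv t ht⟩
  filter_upwards [Ioo_mem_nhds ht.1 ht.2] with s hs using (hL.differentiableAt s hs).hasDerivAt

theorem IsCurvatureBound.le_of_isCurvatureBound (hL : IsCurvatureBound ρ₀ ρ₁ L)
    (hL' : IsCurvatureBound ρ₀ ρ₁ L') (ht : t ∈ Icc (0 : ℝ) 1) : L t ≤ L' t :=
  sub_nonneg.1 <| nonneg_of_secondDeriv_nonpos (hL'.continuousOn.sub hL.continuousOn)
    (by simp [hL.zero, hL'.zero]) (by simp [hL.one, hL'.one])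
    (fun _ hs => ⟨_, (sub_self _).le, (hL'.hasSecondDerivAt hs).sub (hL.hasSecondDerivAt hs)⟩) t ht

theorem IsCurvatureBound.mutualInfo_le (hL : IsCurvatureBound ρ₀ ρ₁ L) (hE : IsPOVM E)
    (ht : t ∈ Icc (0 : ℝ) 1) : mutualInfo ρ₀ ρ₁ E t ≤ L t :=
  sub_nonneg.1 <| nonneg_of_secondDeriv_nonpos
    (hL.continuousOn.sub (continuous_mutualInfo ρ₀ ρ₁ E).continuousOn)
    (by simp [hL.zero, mutualInfo_zero]) (by simp [hL.one, mutualInfo_one])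
    (fun _ hs => ⟨_, sub_nonpos.2 (curvature_le_neg_fisherInfo hE hs),
      (hL.hasSecondDerivAt hs).sub (hasSecondDerivAt_mutualInfo hE hs)⟩) t ht

end CurvatureBound

section ConvexHull

variable {V : Type*} [AddCommGroup V] [Module ℝ V] {s : Set V}

theorem convexHull_eq_biUnion_image_stdSimplex [FiniteDimensional ℝ V] :
    convexHull ℝ s = ⋃ k ∈ Iic (Module.finrank ℝ V + 1),
      (fun p : (Fin k → ℝ) × (Fin k → V) => ∑ i, p.1 i • p.2 i) ''
        (stdSimplex ℝ (Fin k) ×ˢ univ.pi fun _ => s) := by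
  refine Subset.antisymm (fun x hx => ?_) (iUnion₂_subset fun k _ => ?_)
  · obtain ⟨ι, _, z, w, hz, hind, hw, hw_sum, rfl⟩ := eq_pos_convex_span_of_mem_convexHull hx
    have e := (Fintype.equivFin ι).symm
    refine mem_biUnion (x := Fintype.card ι)
      (hind.card_le_finrank_succ.trans (Nat.add_le_add_right (Submodule.finrank_le _) 1))
      ⟨(w ∘ e, z ∘ e), ⟨⟨fun i => (hw (e i)).le, ?_⟩, fun i _ => hz (mem_range_self (e i))⟩, ?_⟩
    · rw [← hw_sum]
      exact e.sum_comp w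
    · exact e.sum_comp fun i => w i • z i
  · rintro _ ⟨⟨w, z⟩, ⟨⟨hw, hw_sum⟩, hz⟩, rfl⟩
    exact (convex_convexHull ℝ s).sum_mem (fun i _ => hw i) hw_sum
      fun i _ => subset_convexHull ℝ s (hz i (mem_univ i))

theorem isCompact_convexHull [FiniteDimensional ℝ V] [TopologicalSpace V] [ContinuousAdd V]
    [ContinuousSMul ℝ V] (hs : IsCompact s) : IsCompact (convexHull ℝ s) := by
  rw [convexHull_eq_biUnion_image_stdSimplex]
  exact (finite_Iic _).isCompact_biUnion fun k _ =>
    ((isCompact_stdSimplex ℝ (Fin k)).prod (isCompact_univ_pi fun _ => hs)).image (by fun_prop)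

end ConvexHull

section MeasurementSums

variable {n ι : Type*} [DecidableEq n] [Fintype ι] {φ : Matrix n n ℂ → ℝ}

variable (φ) in
/-- The values of `∑_b φ(E_b)` on all measurements `E` with finitely many outcomes. -/
def measurementSums : Set ℝ :=
  {x | ∃ (N : ℕ) (E : Fin N → Matrix n n ℂ), IsPOVM E ∧ ∑ b, φ (E b) = x}

theorem IsPOVM.sum_mem_measurementSums {E : ι → Matrix n n ℂ} (hE : IsPOVM E) :
    ∑ b, φ (E b) ∈ measurementSums φ :=
  ⟨_, E ∘ (Fintype.equivFin ι).symm, hE.comp_equiv _,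
    (Fintype.equivFin ι).symm.sum_comp fun b => φ (E b)⟩

end MeasurementSums

section CompactMeasurementSums

variable {n : Type*}

theorem norm_sq_le_of_posSemidef {A : Matrix n n ℂ} (hA : A.PosSemidef) (i j : n) :
    ‖A i j‖ ^ 2 ≤ ‖A i i‖ * ‖A j j‖ := by
  have hdiag : ∀ k, ∃ a : ℝ, 0 ≤ a ∧ (a : ℂ) = A k k := fun k =>
    RCLike.nonneg_iff_exists_ofReal.1 hA.diag_nonneg
  obtain ⟨a, ha, hai⟩ := hdiag i
  obtain ⟨b, hb, hbj⟩ := hdiag j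
  have hminor := (hA.submatrix ![i, j]).det_nonneg
  have hstar : A j i = star (A i j) := (hA.isHermitian.apply j i).symm
  simp only [Matrix.det_fin_two, Matrix.submatrix_apply, Matrix.cons_val_zero,
    Matrix.cons_val_one, hstar, ← hai, ← hbj, Complex.star_def, Complex.mul_conj'] at hminor
  rw [← hai, ← hbj, Complex.norm_of_nonneg ha, Complex.norm_of_nonneg hb]
  exact sub_nonneg.1 (Complex.zero_le_real.1 (by exact_mod_cast hminor))

variable [Fintype n]

theorem norm_apply_le_norm_trace {A : Matrix n n ℂ} (hA : A.PosSemidef) (i j : n) :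
    ‖A i j‖ ≤ ‖A.trace‖ := by
  have hdiag : ∀ k, ‖A k k‖ ≤ ‖A.trace‖ := fun k => by
    refine CStarAlgebra.norm_le_norm_of_nonneg_of_le hA.diag_nonneg ?_
    exact Finset.single_le_sum (f := fun k => A k k) (fun _ _ => hA.diag_nonneg)
      (Finset.mem_univ k)
  refine le_of_sq_le_sq ?_ (norm_nonneg _)
  calc ‖A i j‖ ^ 2 ≤ ‖A i i‖ * ‖A j j‖ := norm_sq_le_of_posSemidef hA i j
    _ ≤ ‖A.trace‖ ^ 2 := by
      rw [sq]
      exact mul_le_mul (hdiag i) (hdiag j) (norm_nonneg _) (norm_nonneg _)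

theorem isClosed_posSemidef {n : Type*} [Finite n] :
    IsClosed {A : Matrix n n ℂ | A.PosSemidef} := by
  cases nonempty_fintype n
  simp only [Matrix.posSemidef_iff_dotProduct_mulVec, Set.ofPred_and, Set.ofPred_forall]
  refine IsClosed.inter (isClosed_eq (by fun_prop) continuous_id) (isClosed_iInter fun x => ?_)
  refine isClosed_le continuous_const ?_
  simp only [dotProduct, Matrix.mulVec]
  fun_prop

theorem isCompact_posSemidef_trace_eq (c : ℂ) :
    IsCompact {A : Matrix n n ℂ | A.PosSemidef ∧ A.trace = c} := by
  have hball : IsCompact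
      (univ.pi fun _ : n => univ.pi fun _ : n => Metric.closedBall (0 : ℂ) ‖c‖) :=
    isCompact_univ_pi fun _ => isCompact_univ_pi fun _ => isCompact_closedBall 0 _
  refine IsCompact.of_isClosed_subset (X := Matrix n n ℂ) hball
    (isClosed_posSemidef.inter (isClosed_eq (by fun_prop) continuous_const)) ?_
  rintro A ⟨hA, rfl⟩ i - j -
  exact mem_closedBall_zero_iff.2 (norm_apply_le_norm_trace hA i j)

theorem exists_eq_smul_of_posSemidef [Nonempty n] {A : Matrix n n ℂ} (hA : A.PosSemidef) :
    ∃ F : Matrix n n ℂ, (F.PosSemidef ∧ F.trace = Fintype.card n) ∧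
      A = ((A.trace.re / Fintype.card n : ℝ) : ℂ) • F := by
  classical
  have hcard : (Fintype.card n : ℂ) ≠ 0 := Nat.cast_ne_zero.2 Fintype.card_ne_zero
  obtain ⟨r, hr, htrace⟩ := RCLike.nonneg_iff_exists_ofReal.1 hA.trace_nonneg
  rcases eq_or_ne r 0 with rfl | hr₀
  · have hzero : A = 0 := hA.trace_eq_zero_iff.1 (by simp [← htrace])
    exact ⟨1, ⟨Matrix.PosSemidef.one, Matrix.trace_one⟩, by simp [hzero]⟩
  · refine ⟨((Fintype.card n / r : ℝ) : ℂ) • A,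
      ⟨hA.smul (Complex.zero_le_real.2 (by positivity)), ?_⟩, ?_⟩
    · rw [Matrix.trace_smul, ← htrace]
      simp [hr₀]
    · have hr_ne : (r : ℂ) ≠ 0 := Complex.ofReal_ne_zero.2 hr₀
      rw [smul_smul, ← htrace]
      simp [hr_ne, hcard]

variable [DecidableEq n] {φ : Matrix n n ℂ → ℝ}

theorem IsPOVM.sum_mem_convexHull [Nonempty n] (hsmul : ∀ (c : ℝ) F, φ ((c : ℂ) • F) = c * φ F)
    {ι : Type*} [Fintype ι] {E : ι → Matrix n n ℂ} (hE : IsPOVM E) :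
    (1, ∑ b, φ (E b)) ∈ convexHull ℝ ((fun F => (F, φ F)) ''
      {F : Matrix n n ℂ | F.PosSemidef ∧ F.trace = Fintype.card n}) := by
  choose F hF hEF using fun b => exists_eq_smul_of_posSemidef (hE.posSemidef b)
  have hcard : (Fintype.card n : ℝ) ≠ 0 := Nat.cast_ne_zero.2 Fintype.card_ne_zero
  have hweight : ∑ b, (E b).trace.re / Fintype.card n = 1 := by
    rw [← Finset.sum_div, ← Complex.re_sum, ← Matrix.trace_sum, hE.sum_eq_one, Matrix.trace_one,
      Complex.natCast_re, div_self hcard]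
  have hsum : ∑ b, ((E b).trace.re / Fintype.card n) • (F b, φ (F b)) =
      (1, ∑ b, φ (E b)) := by
    refine Prod.ext ?_ ?_
    · rw [Prod.fst_sum, ← hE.sum_eq_one]
      exact Finset.sum_congr rfl fun b _ => (Complex.coe_smul _ _).symm.trans (hEF b).symm
    · rw [Prod.snd_sum]
      refine Finset.sum_congr rfl fun b _ => ?_
      rw [Prod.smul_snd, smul_eq_mul, ← hsmul, ← hEF]
  rw [← hsum]
  exact (convex_convexHull ℝ _).sum_mem
    (fun b _ => div_nonneg (RCLike.nonneg_iff.1 (hE.posSemidef b).trace_nonneg).1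
      (Nat.cast_nonneg _)) hweight fun b _ => subset_convexHull ℝ _ ⟨F b, hF b, rfl⟩

theorem measurementSums_eq_preimage [Nonempty n]
    (hsmul : ∀ (c : ℝ) F, φ ((c : ℂ) • F) = c * φ F) :
    measurementSums φ = Prod.mk 1 ⁻¹' convexHull ℝ ((fun F => (F, φ F)) ''
      {F : Matrix n n ℂ | F.PosSemidef ∧ F.trace = Fintype.card n}) := by
  refine Subset.antisymm ?_ fun x hx => ?_
  · rintro _ ⟨N, E, hE, rfl⟩
    exact hE.sum_mem_convexHull hsmul
  obtain ⟨ι, _, w, y, hw, -, hy, hsum⟩ := mem_convexHull_iff_exists_fintype.1 hx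
  choose F hF hFy using hy
  have hE : IsPOVM fun i => ((w i : ℝ) : ℂ) • F i := by
    refine ⟨fun i => (hF i).1.smul (Complex.zero_le_real.2 (hw i)), ?_⟩
    simpa only [← hFy, Prod.fst_sum, Prod.smul_fst, Complex.coe_smul] using congrArg Prod.fst hsum
  have hval : ∑ i, w i * φ (F i) = x := by
    simpa only [← hFy, Prod.snd_sum, Prod.smul_snd, smul_eq_mul] using congrArg Prod.snd hsum
  rw [← hval]
  simpa only [hsmul] using hE.sum_mem_measurementSums (φ := φ)

theorem isCompact_measurementSums {n : Type*} [Finite n] [DecidableEq n] [Nonempty n]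
    {φ : Matrix n n ℂ → ℝ} (hφ : Continuous φ)
    (hsmul : ∀ (c : ℝ) F, φ ((c : ℂ) • F) = c * φ F) : IsCompact (measurementSums φ) := by
  cases nonempty_fintype n
  rw [measurementSums_eq_preimage hsmul]
  have hhull := isCompact_convexHull ((isCompact_posSemidef_trace_eq (n := n)
    (Fintype.card n)).image (continuous_id.prodMk hφ))
  exact (hhull.image continuous_snd).of_isClosed_subset (hhull.isClosed.preimage (by fun_prop))
    fun x hx => ⟨_, hx, rfl⟩

end CompactMeasurementSums

section AccessibleInformation

variable {n : Type*} [Fintype n] {ρ₀ ρ₁ : DensityOperator n}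

theorem DensityOperator.nonempty (ρ : DensityOperator n) : Nonempty n := by
  by_contra hempty
  rw [not_nonempty_iff] at hempty
  simpa [Matrix.trace] using ρ.trace_eq_one

variable [DecidableEq n]

theorem mutualInfoValues_eq_measurementSums (ρ₀ ρ₁ : DensityOperator n) (t : ℝ) :
    mutualInfoValues ρ₀ ρ₁ t =
      measurementSums fun F => outcomeInfo (prob ρ₀.op F) (prob ρ₁.op F) t := by
  simp only [mutualInfoValues, measurementSums, mutualInfo_eq_sum_outcomeInfo]

theorem isCompact_mutualInfoValues (ρ₀ ρ₁ : DensityOperator n) (t : ℝ) :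
    IsCompact (mutualInfoValues ρ₀ ρ₁ t) := by
  have := ρ₀.nonempty
  rw [mutualInfoValues_eq_measurementSums]
  refine isCompact_measurementSums ?_ fun c F => ?_
  · unfold prob
    fun_prop
  · rw [prob_smul_right, prob_smul_right, outcomeInfo_mul]

theorem isGreatest_accessibleInfo (ρ₀ ρ₁ : DensityOperator n) (t : ℝ) :
    IsGreatest (mutualInfoValues ρ₀ ρ₁ t) (accessibleInfo ρ₀ ρ₁ t) :=
  (isCompact_mutualInfoValues ρ₀ ρ₁ t).isGreatest_sSup
    ⟨_, (isPOVM_basisMeasurement (EuclideanSpace.basisFun n ℂ)).mutualInfo_mem ρ₀ ρ₁ t⟩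

theorem IsCurvatureBound.accessibleInfo_le {L : ℝ → ℝ} {t : ℝ} (hL : IsCurvatureBound ρ₀ ρ₁ L)
    (ht : t ∈ Icc (0 : ℝ) 1) : accessibleInfo ρ₀ ρ₁ t ≤ L t := by
  obtain ⟨N, E, hE, hmax⟩ := (isGreatest_accessibleInfo ρ₀ ρ₁ t).1
  rw [← hmax]
  exact hL.mutualInfo_le hE ht

end AccessibleInformation

section Klein

theorem neg_sq_mul_norm_sq_div_le {m : ℝ} (hm : 0 < m) (x : ℝ) (w y : ℂ) :
    -(x ^ 2 / (2 * m) * ‖w‖ ^ 2) ≤ -(x * (star w * y).re) + m / 2 * ‖y‖ ^ 2 := by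
  have hsquare : 0 ≤ ((x * w.re - m * y.re) ^ 2 + (x * w.im - m * y.im) ^ 2) / (2 * m) := by
    positivity
  have hexpand : ((x * w.re - m * y.re) ^ 2 + (x * w.im - m * y.im) ^ 2) / (2 * m) =
      x ^ 2 / (2 * m) * ‖w‖ ^ 2 - x * (star w * y).re + m / 2 * ‖y‖ ^ 2 := by
    simp only [Complex.sq_norm, Complex.normSq_apply, Complex.star_def, Complex.mul_re,
      Complex.conj_re, Complex.conj_im]
    field_simp
    ring
  linarith

theorem negMulLog_mul_norm_sq_le {a b : ℝ} {w : ℂ} (ha : a ∈ Icc (0 : ℝ) 1)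
    (hb : b ∈ Icc (0 : ℝ) 1) (hsupp : b = 0 → a * w = 0) (y : ℂ) :
    Real.negMulLog a * ‖w‖ ^ 2 ≤
      -(Real.log b * (a * ‖w‖ ^ 2)) - (a - b) * ‖w‖ ^ 2 - (a - b) * (star w * y).re
        + (a + 2 * b) * ‖y‖ ^ 2 / 6 - ((a - b) ^ 2 * ‖w‖) ^ 2 / 108 := by
  rcases hb.1.eq_or_lt with rfl | hb₀
  · rcases mul_eq_zero.1 (hsupp rfl) with ha₀ | rfl
    · simp [Complex.ofReal_eq_zero.1 ha₀]
    · have : 0 ≤ a * ‖y‖ ^ 2 / 6 := by have := ha.1; positivity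
      simpa using this
  · have hm : 0 < (a + 2 * b) / 3 := by linarith [ha.1]
    have hscalar := mul_le_mul_of_nonneg_right (negMulLog_le_sub ha ⟨hb₀, hb.2⟩) (sq_nonneg ‖w‖)
    linarith [neg_sq_mul_norm_sq_div_le hm (a - b) w y]

variable {n : Type*} [Fintype n]
  {u v : OrthonormalBasis n ℂ (EuclideanSpace ℂ n)} {A B Y : Matrix n n ℂ} {a b : n → ℝ}

/-- The cross entropy `-tr(A ln B)`, where `v` is an orthonormal eigenbasis of `B` and `b` are the
eigenvalues. -/
noncomputable def crossEntropy (v : OrthonormalBasis n ℂ (EuclideanSpace ℂ n)) (b : n → ℝ)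
    (A : Matrix n n ℂ) : ℝ :=
  -∑ j, Real.log (b j) * prob A (basisMeasurement v j)

theorem crossEntropy_add (A B : Matrix n n ℂ) :
    crossEntropy v b (A + B) = crossEntropy v b A + crossEntropy v b B := by
  simp only [crossEntropy, prob_add_left, mul_add, Finset.sum_add_distrib, neg_add]

theorem crossEntropy_smul (r : ℝ) (A : Matrix n n ℂ) :
    crossEntropy v b ((r : ℂ) • A) = r * crossEntropy v b A := by
  simp only [crossEntropy, prob_smul_left, mul_neg, Finset.mul_sum, mul_left_comm]

theorem IsEigensystem.crossEntropy_self (hB : IsEigensystem B v b) :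
    crossEntropy v b B = ∑ j, Real.negMulLog (b j) := by
  simp only [crossEntropy, hB.prob_basisMeasurement_self, ← Finset.sum_neg_distrib,
    Real.negMulLog_eq_neg, mul_comm]

theorem IsEigensystem.crossEntropy_eq_sum [DecidableEq n] (hA : IsEigensystem A u a) :
    crossEntropy v b A =
      ∑ i, ∑ j, -(Real.log (b j) * (a i * ‖matrixElements u v 1 i j‖ ^ 2)) := by
  rw [Finset.sum_comm]
  simp only [crossEntropy, hA.prob_basisMeasurement_eq_sum v, Finset.mul_sum,
    Finset.sum_neg_distrib]

theorem IsEigensystem.matrixElements_sub_apply [DecidableEq n] (hA : IsEigensystem A u a)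
    (hB : IsEigensystem B v b) (i j : n) :
    matrixElements u v (A - B) i j = ((a i - b j : ℝ) : ℂ) * matrixElements u v 1 i j := by
  rw [matrixElements_sub, Matrix.sub_apply, hA.matrixElements_left, hB.matrixElements_right]
  push_cast
  ring

theorem IsEigensystem.prob_sub_eq_sum [DecidableEq n] (hA : IsEigensystem A u a)
    (hB : IsEigensystem B v b) (Y : Matrix n n ℂ) :
    prob (A - B) Y =
      ∑ i, ∑ j, (a i - b j) * (star (matrixElements u v 1 i j) * matrixElements u v Y i j).re := by
  rw [← (hA.isHermitian.sub hB.isHermitian).eq, prob_conjTranspose_eq_sum u v]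
  simp only [hA.matrixElements_sub_apply hB, star_mul', Complex.star_def, Complex.conj_ofReal,
    mul_assoc, Complex.re_ofReal_mul]

theorem IsEigensystem.prob_add_two_mul_sq_eq_sum (hA : IsEigensystem A u a)
    (hB : IsEigensystem B v b) (hY : Y.IsHermitian) :
    prob A (Y * Y) + 2 * prob B (Y * Y) =
      ∑ i, ∑ j, (a i + 2 * b j) * ‖matrixElements u v Y i j‖ ^ 2 := by
  have hleft : prob A (Y * Y) = ∑ i, ∑ j, a i * ‖matrixElements u v Y i j‖ ^ 2 := by
    have hcycle : prob A (Y * Y) = prob Yᴴ (A * Y) := by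
      rw [hY.eq, prob_comm, prob_mul_left_comm]
    rw [hcycle, prob_conjTranspose_eq_sum u v]
    simp only [hA.matrixElements_mul_left, mul_left_comm _ (a _ : ℂ), Complex.star_def,
      Complex.conj_mul', Complex.re_ofReal_mul, ← Complex.ofReal_pow, Complex.ofReal_re]
  have hright : prob B (Y * Y) = ∑ i, ∑ j, b j * ‖matrixElements u v Y i j‖ ^ 2 := by
    have hcycle : prob B (Y * Y) = prob Yᴴ (Y * B) := by
      rw [hY.eq, ← prob_mul_left_comm, prob_comm]
    rw [hcycle, prob_conjTranspose_eq_sum u v]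
    simp only [hB.matrixElements_mul_right, ← mul_assoc, Complex.star_def,
      Complex.conj_mul', ← Complex.ofReal_pow, ← Complex.ofReal_mul, Complex.ofReal_re,
      mul_comm _ (b _)]
  rw [hleft, hright]
  simp only [Finset.mul_sum, ← Finset.sum_add_distrib]
  refine Finset.sum_congr rfl fun i _ => Finset.sum_congr rfl fun j _ => by ring

theorem IsEigensystem.hilbertSchmidtSq_eq_sum [DecidableEq n] (hA : IsEigensystem A u a)
    (hB : IsEigensystem B v b) :
    hilbertSchmidtSq (A * (A - B) - (A - B) * B) =
      ∑ i, ∑ j, ((a i - b j) ^ 2 * ‖matrixElements u v 1 i j‖) ^ 2 := by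
  rw [BinaryChannel.hilbertSchmidtSq_eq_sum u v]
  refine Finset.sum_congr rfl fun i _ => Finset.sum_congr rfl fun j _ => ?_
  have helement : matrixElements u v (A * (A - B) - (A - B) * B) i j =
      (((a i - b j) ^ 2 : ℝ) : ℂ) * matrixElements u v 1 i j := by
    rw [matrixElements_sub, Matrix.sub_apply, hA.matrixElements_mul_left,
      hB.matrixElements_mul_right, hA.matrixElements_sub_apply hB]
    push_cast
    ring
  rw [helement, norm_mul, Complex.norm_real, Real.norm_of_nonneg (sq_nonneg _)]

theorem IsEigensystem.mul_matrixElements_one_eq_zero [DecidableEq n] (hA : IsEigensystem A u a)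
    (hB : IsEigensystem B v b) (hsupp : ∀ x, B *ᵥ x = 0 → A *ᵥ x = 0) (i j : n) (hj : b j = 0) :
    a i * matrixElements u v 1 i j = 0 := by
  rw [← hA.matrixElements_left, matrixElements_apply, hsupp, dotProduct_zero]
  rw [hB j, hj, Complex.ofReal_zero, zero_smul]

theorem sum_sub_mul_norm_sq [DecidableEq n] (htrace : ∑ i, a i = ∑ j, b j) :
    ∑ i, ∑ j, (a i - b j) * ‖matrixElements u v 1 i j‖ ^ 2 = 0 := by
  simp only [sub_mul, Finset.sum_sub_distrib]
  conv_lhs => rw [sub_eq_add_neg]; arg 2; rw [Finset.sum_comm]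
  simp only [← Finset.mul_sum, sum_norm_sq_matrixElements_one_right,
    sum_norm_sq_matrixElements_one_left, mul_one, htrace, add_neg_cancel]

/- A matrix-element version of Klein's inequality `S(A) ≤ -tr(A ln B)`, improved to second order
in `A - B` by the auxiliary operator `Y` and with the surplus in the commutator-like operator. -/
theorem IsEigensystem.sum_negMulLog_le (hA : IsEigensystem A u a) (hB : IsEigensystem B v b)
    (ha : ∀ i, a i ∈ Icc (0 : ℝ) 1) (hb : ∀ j, b j ∈ Icc (0 : ℝ) 1)
    (htrace : ∑ i, a i = ∑ j, b j) (hsupp : ∀ x, B *ᵥ x = 0 → A *ᵥ x = 0)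
    (hY : Y.IsHermitian) :
    ∑ i, Real.negMulLog (a i) ≤
      crossEntropy v b A - prob (A - B) Y + (prob A (Y * Y) + 2 * prob B (Y * Y)) / 6
        - hilbertSchmidtSq (A * (A - B) - (A - B) * B) / 108 := by
  classical
  have hterm := fun i j => negMulLog_mul_norm_sq_le (ha i) (hb j)
    (hA.mul_matrixElements_one_eq_zero hB hsupp i j) (matrixElements u v Y i j)
  calc ∑ i, Real.negMulLog (a i)
      = ∑ i, ∑ j, Real.negMulLog (a i) * ‖matrixElements u v 1 i j‖ ^ 2 := by
        simp only [← Finset.mul_sum, sum_norm_sq_matrixElements_one_right, mul_one]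
    _ ≤ _ := Finset.sum_le_sum fun i _ => Finset.sum_le_sum fun j _ => hterm i j
    _ = _ := by
        rw [hA.crossEntropy_eq_sum, hA.prob_sub_eq_sum hB, hA.prob_add_two_mul_sq_eq_sum hB hY,
          hA.hilbertSchmidtSq_eq_sum hB]
        simp only [Finset.sum_sub_distrib, Finset.sum_add_distrib, ← Finset.sum_div,
          sum_sub_mul_norm_sq htrace, sub_zero]

end Klein

section Commutator

variable {n : Type*} [Fintype n] {B D : Matrix n n ℂ}

theorem hilbertSchmidtSq_nonneg (A : Matrix n n ℂ) : 0 ≤ hilbertSchmidtSq A :=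
  (RCLike.nonneg_iff.1 (Matrix.posSemidef_conjTranspose_mul_self A).trace_nonneg).1

theorem eq_zero_of_hilbertSchmidtSq_nonpos {A : Matrix n n ℂ} (h : hilbertSchmidtSq A ≤ 0) :
    A = 0 :=
  Matrix.trace_conjTranspose_mul_self_eq_zero_iff.1 <| Complex.ext
    (h.antisymm (hilbertSchmidtSq_nonneg A))
    (RCLike.nonneg_iff.1 (Matrix.posSemidef_conjTranspose_mul_self A).trace_nonneg).2

theorem hilbertSchmidtSq_smul (r : ℝ) (A : Matrix n n ℂ) :
    hilbertSchmidtSq ((r : ℂ) • A) = r ^ 2 * hilbertSchmidtSq A := by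
  rw [hilbertSchmidtSq, Matrix.conjTranspose_smul, Complex.star_def, Complex.conj_ofReal,
    prob_smul_left, prob_smul_right, hilbertSchmidtSq]
  ring

theorem hilbertSchmidtSq_add (A B : Matrix n n ℂ) :
    hilbertSchmidtSq (A + B) = hilbertSchmidtSq A + 2 * prob Aᴴ B + hilbertSchmidtSq B := by
  have hswap : prob Bᴴ A = prob Aᴴ B := by
    have h := congrArg Complex.re (Matrix.trace_conjTranspose (Bᴴ * A))
    rw [Matrix.conjTranspose_mul, Matrix.conjTranspose_conjTranspose] at h
    exact h.symm
  simp only [hilbertSchmidtSq, Matrix.conjTranspose_add, prob_add_left, prob_add_right, hswap]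
  ring

theorem hilbertSchmidtSq_commutator_le (hB : B.IsHermitian) (hD : D.IsHermitian) (r : ℝ) :
    hilbertSchmidtSq (B * D - D * B) ≤ hilbertSchmidtSq ((B + (r : ℂ) • D) * D - D * B) := by
  have hDD : (D * D).IsHermitian := by
    rw [Matrix.IsHermitian, Matrix.conjTranspose_mul, hD.eq]
  have horthogonal : prob (B * D - D * B)ᴴ ((r : ℂ) • (D * D)) = 0 := by
    rw [Matrix.conjTranspose_sub, Matrix.conjTranspose_mul, Matrix.conjTranspose_mul, hB.eq, hD.eq,
      prob_smul_right, prob_sub_left, prob_mul_swap hD hB hDD, sub_self, mul_zero]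
  have hsplit : (B + (r : ℂ) • D) * D - D * B = (B * D - D * B) + (r : ℂ) • (D * D) := by
    rw [Matrix.add_mul, Matrix.smul_mul]
    abel
  rw [hsplit, hilbertSchmidtSq_add, horthogonal]
  linarith [hilbertSchmidtSq_nonneg ((r : ℂ) • (D * D))]

/-- The squared Hilbert-Schmidt norm of the commutator of the two signal states, which bounds
the gap between the accessible information and the Holevo quantity from below. -/
noncomputable def commutatorSq (ρ₀ ρ₁ : DensityOperator n) : ℝ :=
  hilbertSchmidtSq (ρ₀.op * ρ₁.op - ρ₁.op * ρ₀.op)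

theorem mean_mul_diff_sub (ρ₀ ρ₁ : DensityOperator n) (t : ℝ) :
    mean ρ₀ ρ₁ t * diff ρ₀ ρ₁ - diff ρ₀ ρ₁ * mean ρ₀ ρ₁ t =
      ρ₀.op * ρ₁.op - ρ₁.op * ρ₀.op := by
  simp only [mean, diff, Matrix.add_mul, Matrix.mul_add, Matrix.sub_mul, Matrix.mul_sub,
    Matrix.smul_mul, Matrix.mul_smul]
  push_cast
  module

theorem sq_mul_commutatorSq_le (ρ₀ ρ₁ : DensityOperator n) (s t : ℝ) :
    (s - t) ^ 2 * commutatorSq ρ₀ ρ₁ ≤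
      hilbertSchmidtSq (mean ρ₀ ρ₁ s * (mean ρ₀ ρ₁ s - mean ρ₀ ρ₁ t)
        - (mean ρ₀ ρ₁ s - mean ρ₀ ρ₁ t) * mean ρ₀ ρ₁ t) := by
  have hs : mean ρ₀ ρ₁ s = mean ρ₀ ρ₁ t + ((s - t : ℝ) : ℂ) • diff ρ₀ ρ₁ :=
    eq_add_of_sub_eq' (mean_sub_mean ρ₀ ρ₁ s t)
  rw [mean_sub_mean, Matrix.mul_smul, Matrix.smul_mul, ← smul_sub, hilbertSchmidtSq_smul, hs,
    commutatorSq, ← mean_mul_diff_sub ρ₀ ρ₁ t]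
  gcongr
  exact hilbertSchmidtSq_commutator_le (mean_isHermitian ρ₀ ρ₁ t) (diff_isHermitian ρ₀ ρ₁) _

end Commutator

section Entropy

variable {n : Type*} [Fintype n] [DecidableEq n]
  {A : Matrix n n ℂ} {a : n → ℝ}
  {u : OrthonormalBasis n ℂ (EuclideanSpace ℂ n)}

theorem IsEigensystem.vonNeumannEntropy_eq (hA : IsEigensystem A u a) (hAH : A.IsHermitian) :
    vonNeumannEntropy hAH = ∑ j, Real.negMulLog (a j) :=
  (isEigensystem_eigenvectorBasis hAH).sum_comp_eq hA Real.negMulLog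

theorem vonNeumannEntropy_eq_trace_cfc (hA : A.IsHermitian) :
    vonNeumannEntropy hA = (cfc Real.negMulLog A).trace.re := by
  rw [hA.cfc_eq, Matrix.IsHermitian.cfc, Unitary.conjStarAlgAut_apply, Matrix.trace_mul_cycle,
    Unitary.coe_star_mul_self, Matrix.one_mul, Matrix.trace_diagonal]
  simp [vonNeumannEntropy]

open scoped Matrix.Norms.L2Operator in
theorem continuousOn_vonNeumannEntropy_mean (ρ₀ ρ₁ : DensityOperator n) :
    ContinuousOn (fun s => vonNeumannEntropy (mean_isHermitian ρ₀ ρ₁ s)) (Icc 0 1) := by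
  simp only [vonNeumannEntropy_eq_trace_cfc]
  have hcfc : ContinuousOn (fun s => cfc Real.negMulLog (mean ρ₀ ρ₁ s)) (Icc 0 1) := by
    refine ContinuousOn.cfc' (isCompact_Icc (a := 0) (b := 1)) _ ?_ ?_ ?_
      Real.continuous_negMulLog.continuousOn
    · unfold mean
      fun_prop
    · intro s hs
      rw [(mean_isHermitian ρ₀ ρ₁ s).spectrum_real_eq_range_eigenvalues]
      rintro _ ⟨j, rfl⟩
      exact (isEigensystem_eigenvectorBasis (mean_isHermitian ρ₀ ρ₁ s)).mem_Icc
        (mean_posSemidef ρ₀ ρ₁ hs) (trace_mean ρ₀ ρ₁ s) j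
    · exact fun s _ => mean_isHermitian ρ₀ ρ₁ s
  fun_prop

end Entropy

section HolevoBound

variable {n : Type*} [Fintype n] [DecidableEq n]
  {ρ₀ ρ₁ : DensityOperator n} {L : ℝ → ℝ} {s t : ℝ}

theorem holevo_zero (ρ₀ ρ₁ : DensityOperator n) : holevo ρ₀ ρ₁ 0 = 0 := by
  simp [holevo, mean_zero]

theorem holevo_one (ρ₀ ρ₁ : DensityOperator n) : holevo ρ₀ ρ₁ 1 = 0 := by
  simp [holevo, mean_one]

theorem continuousOn_holevo (ρ₀ ρ₁ : DensityOperator n) :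
    ContinuousOn (holevo ρ₀ ρ₁) (Icc 0 1) := by
  have := continuousOn_vonNeumannEntropy_mean ρ₀ ρ₁
  unfold holevo
  fun_prop

theorem prob_mean_smul_loweredDiff_sq (ht : t ∈ Ioo (0 : ℝ) 1) (r c : ℝ) :
    prob (mean ρ₀ ρ₁ r) ((c : ℂ) • loweredDiff ρ₀ ρ₁ t * (c : ℂ) • loweredDiff ρ₀ ρ₁ t) =
      c ^ 2 * (-curvature ρ₀ ρ₁ t
        + (r - t) * prob (diff ρ₀ ρ₁) (loweredDiff ρ₀ ρ₁ t * loweredDiff ρ₀ ρ₁ t)) := by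
  rw [eq_add_of_sub_eq' (mean_sub_mean ρ₀ ρ₁ r t), Matrix.smul_mul, Matrix.mul_smul,
    prob_smul_right, prob_smul_right, prob_add_left, prob_smul_left,
    (isSymmLogDeriv_loweredDiff ht).prob_mul_self (mean_isHermitian ρ₀ ρ₁ t),
    curvature_eq_neg_prob]
  ring

/- Klein's inequality for `A = ρ(s)` and `B = ρ(t)`; the choice `Y = (s - t) 𝓛_ρ(Δ)` of the
auxiliary operator makes the quadratic term equal to half the curvature. -/
theorem vonNeumannEntropy_mean_le (hs : s ∈ Icc (0 : ℝ) 1) (ht : t ∈ Ioo (0 : ℝ) 1) :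
    vonNeumannEntropy (mean_isHermitian ρ₀ ρ₁ s) ≤
      vonNeumannEntropy (mean_isHermitian ρ₀ ρ₁ t)
        + (s - t) * crossEntropy (mean_isHermitian ρ₀ ρ₁ t).eigenvectorBasis
            (mean_isHermitian ρ₀ ρ₁ t).eigenvalues (diff ρ₀ ρ₁)
        + (curvature ρ₀ ρ₁ t / 2 - commutatorSq ρ₀ ρ₁ / 108) * (s - t) ^ 2
        + prob (diff ρ₀ ρ₁) (loweredDiff ρ₀ ρ₁ t * loweredDiff ρ₀ ρ₁ t) / 6 * (s - t) ^ 3 := by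
  have hA := isEigensystem_eigenvectorBasis (mean_isHermitian ρ₀ ρ₁ s)
  have hB := isEigensystem_eigenvectorBasis (mean_isHermitian ρ₀ ρ₁ t)
  have hY : (((s - t : ℝ) : ℂ) • loweredDiff ρ₀ ρ₁ t).IsHermitian := by
    rw [Matrix.IsHermitian, Matrix.conjTranspose_smul, Complex.star_def, Complex.conj_ofReal,
      (loweredDiff_isHermitian ρ₀ ρ₁ t).eq]
  have hklein := hA.sum_negMulLog_le hB
    (hA.mem_Icc (mean_posSemidef ρ₀ ρ₁ hs) (trace_mean ρ₀ ρ₁ s))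
    (hB.mem_Icc (mean_posSemidef ρ₀ ρ₁ (Ioo_subset_Icc_self ht)) (trace_mean ρ₀ ρ₁ t))
    (by rw [hA.sum_eq_trace, hB.sum_eq_trace, trace_mean, trace_mean])
    (fun x hx => mean_mulVec_eq_zero ht hx s) hY
  have hmean : mean ρ₀ ρ₁ s = mean ρ₀ ρ₁ t + ((s - t : ℝ) : ℂ) • diff ρ₀ ρ₁ :=
    eq_add_of_sub_eq' (mean_sub_mean ρ₀ ρ₁ s t)
  have hcross : crossEntropy (mean_isHermitian ρ₀ ρ₁ t).eigenvectorBasis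
      (mean_isHermitian ρ₀ ρ₁ t).eigenvalues (mean ρ₀ ρ₁ s) =
        vonNeumannEntropy (mean_isHermitian ρ₀ ρ₁ t)
          + (s - t) * crossEntropy (mean_isHermitian ρ₀ ρ₁ t).eigenvectorBasis
            (mean_isHermitian ρ₀ ρ₁ t).eigenvalues (diff ρ₀ ρ₁) := by
    rw [hmean, crossEntropy_add, crossEntropy_smul, hB.crossEntropy_self, vonNeumannEntropy]
  have hfirst : prob (mean ρ₀ ρ₁ s - mean ρ₀ ρ₁ t) (((s - t : ℝ) : ℂ) • loweredDiff ρ₀ ρ₁ t) =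
      -(s - t) ^ 2 * curvature ρ₀ ρ₁ t := by
    rw [mean_sub_mean, prob_smul_left, prob_smul_right, curvature_eq_neg_prob]
    ring
  rw [hcross, hfirst, prob_mean_smul_loweredDiff_sq ht, prob_mean_smul_loweredDiff_sq ht] at hklein
  rw [vonNeumannEntropy]
  linarith [sq_mul_commutatorSq_le ρ₀ ρ₁ s t]

theorem exists_cubic_ge_holevo (ρ₀ ρ₁ : DensityOperator n) (ht : t ∈ Ioo (0 : ℝ) 1) :
    ∃ c₁ c₃ : ℝ, ∀ s ∈ Icc (0 : ℝ) 1,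
      holevo ρ₀ ρ₁ s - commutatorSq ρ₀ ρ₁ / 108 * (s * (1 - s)) ≤
        holevo ρ₀ ρ₁ t - commutatorSq ρ₀ ρ₁ / 108 * (t * (1 - t)) + c₁ * (s - t)
          + curvature ρ₀ ρ₁ t / 2 * (s - t) ^ 2 + c₃ * (s - t) ^ 3 := by
  refine ⟨crossEntropy (mean_isHermitian ρ₀ ρ₁ t).eigenvectorBasis
      (mean_isHermitian ρ₀ ρ₁ t).eigenvalues (diff ρ₀ ρ₁)
      + vonNeumannEntropy ρ₀.posSemidef.isHermitian - vonNeumannEntropy ρ₁.posSemidef.isHermitian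
      - commutatorSq ρ₀ ρ₁ / 108 * (1 - 2 * t),
    prob (diff ρ₀ ρ₁) (loweredDiff ρ₀ ρ₁ t * loweredDiff ρ₀ ρ₁ t) / 6, fun s hs => ?_⟩
  have := vonNeumannEntropy_mean_le (ρ₀ := ρ₀) (ρ₁ := ρ₁) hs ht
  unfold holevo
  linarith

theorem IsCurvatureBound.add_commutatorSq_le_holevo (hL : IsCurvatureBound ρ₀ ρ₁ L)
    (ht : t ∈ Icc (0 : ℝ) 1) :
    L t + commutatorSq ρ₀ ρ₁ / 108 * (t * (1 - t)) ≤ holevo ρ₀ ρ₁ t := by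
  have hcont : ContinuousOn
      (fun s => holevo ρ₀ ρ₁ s - commutatorSq ρ₀ ρ₁ / 108 * (s * (1 - s)) - L s) (Icc 0 1) := by
    have := continuousOn_holevo ρ₀ ρ₁
    have := hL.continuousOn
    fun_prop
  have hgap := nonneg_of_touchedAbove hcont (by simp [holevo_zero, hL.zero])
    (by simp [holevo_one, hL.one]) (fun s hs => ?_) t ht
  · linarith
  · obtain ⟨c₁, c₃, hcubic⟩ := exists_cubic_ge_holevo ρ₀ ρ₁ hs
    refine ⟨_, _, ?_, ?_, (hasSecondDerivAt_cubic
      (holevo ρ₀ ρ₁ s - commutatorSq ρ₀ ρ₁ / 108 * (s * (1 - s))) c₁ (curvature ρ₀ ρ₁ s) c₃ s).sub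
        (hL.hasSecondDerivAt hs), (sub_self _).le⟩
    · filter_upwards [Icc_mem_nhds hs.1 hs.2] with r hr using sub_le_sub_right (hcubic r hr) _
    · simp

theorem IsCurvatureBound.le_holevo (hL : IsCurvatureBound ρ₀ ρ₁ L) (ht : t ∈ Icc (0 : ℝ) 1) :
    L t ≤ holevo ρ₀ ρ₁ t := by
  refine le_trans (le_add_of_nonneg_right ?_) (hL.add_commutatorSq_le_holevo ht)
  exact mul_nonneg (div_nonneg (hilbertSchmidtSq_nonneg _) (by norm_num))
    (mul_nonneg ht.1 (sub_nonneg.2 ht.2))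

theorem commute_of_accessibleInfo_eq_holevo (ht : t ∈ Ioo (0 : ℝ) 1)
    (h : accessibleInfo ρ₀ ρ₁ t = holevo ρ₀ ρ₁ t) : Commute ρ₀.op ρ₁.op := by
  obtain ⟨L, hL⟩ := exists_isCurvatureBound ρ₀ ρ₁
  have htIcc := Ioo_subset_Icc_self ht
  have hgap : commutatorSq ρ₀ ρ₁ / 108 * (t * (1 - t)) ≤ 0 := by
    linarith [hL.accessibleInfo_le htIcc, hL.add_commutatorSq_le_holevo htIcc]
  have hzero : commutatorSq ρ₀ ρ₁ ≤ 0 := by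
    have := nonpos_of_mul_nonpos_left hgap (mul_pos ht.1 (sub_pos.2 ht.2))
    linarith
  exact sub_eq_zero.1 (eq_zero_of_hilbertSchmidtSq_nonpos hzero)

end HolevoBound

section JointEigenbasis

open Module.End

theorem exists_orthonormalBasis_mem_eigenspace_inf {E : Type*} [NormedAddCommGroup E]
    [InnerProductSpace ℂ E] [FiniteDimensional ℂ E] {A B : E →ₗ[ℂ] E} (hA : A.IsSymmetric)
    (hB : B.IsSymmetric) (h : Commute A B) {m : ℕ} (hm : Module.finrank ℂ E = m) :
    ∃ w : OrthonormalBasis (Fin m) ℂ E,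
      ∀ b, ∃ α β : ℂ, w b ∈ eigenspace A α ⊓ eigenspace B β := by
  classical
  have hort := LinearMap.IsSymmetric.orthogonalFamily_eigenspace_inf_eigenspace hA hB
  have hint := DirectSum.isInternal_ne_bot_iff.2
    (LinearMap.IsSymmetric.directSum_isInternal_of_commute hA hB h)
  have hfin : Finite {i : ℂ × ℂ // eigenspace A i.2 ⊓ eigenspace B i.1 ≠ ⊥} :=
    WellFoundedGT.finite_ne_bot_of_iSupIndep hort.independent
  let _ := Fintype.ofFinite {i : ℂ × ℂ // eigenspace A i.2 ⊓ eigenspace B i.1 ≠ ⊥}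
  have hort' := hort.comp (Subtype.val_injective
    (p := fun i : ℂ × ℂ => eigenspace A i.2 ⊓ eigenspace B i.1 ≠ ⊥))
  exact ⟨hint.subordinateOrthonormalBasis hm hort', fun b =>
    ⟨_, _, hint.subordinateOrthonormalBasis_subordinate hm b hort'⟩⟩

variable {n : Type*} [Fintype n] {A : Matrix n n ℂ}
  {v : OrthonormalBasis n ℂ (EuclideanSpace ℂ n)} {ρ₀ ρ₁ : DensityOperator n} {t : ℝ}

theorem isEigenbasis_mean (h₀ : IsEigenbasis v ρ₀.op) (h₁ : IsEigenbasis v ρ₁.op) (t : ℝ) :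
    IsEigenbasis v (mean ρ₀ ρ₁ t) := fun b => by
  obtain ⟨α, hα⟩ := h₀ b
  obtain ⟨β, hβ⟩ := h₁ b
  exact ⟨((1 - t : ℝ) : ℂ) * α + (t : ℂ) * β, by
    rw [mean, Matrix.add_mulVec, Matrix.smul_mulVec, Matrix.smul_mulVec, hα, hβ, smul_smul,
      smul_smul, ← add_smul]⟩

theorem exists_joint_eigenbasis {B : Matrix n n ℂ} (hA : A.IsHermitian) (hB : B.IsHermitian)
    (h : Commute A B) : ∃ v : OrthonormalBasis n ℂ (EuclideanSpace ℂ n),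
      IsEigenbasis v A ∧ IsEigenbasis v B := by
  classical
  have hAB : Commute A.toEuclideanLin B.toEuclideanLin := by
    ext1 x
    have := congrArg (fun M => M *ᵥ x.ofLp) h.eq
    simp only [← Matrix.mulVec_mulVec] at this
    simp [Module.End.mul_apply, Matrix.toLpLin_apply, this]
  obtain ⟨w, hw⟩ := exists_orthonormalBasis_mem_eigenspace_inf
    (Matrix.isSymmetric_toEuclideanLin_iff.mpr hA) (Matrix.isSymmetric_toEuclideanLin_iff.mpr hB)
    hAB finrank_euclideanSpace
  choose α β hαβ using hw
  let e := Fintype.equivFin n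
  have hw_apply (b : n) : w.reindex e.symm b = w (e b) := by
    rw [OrthonormalBasis.reindex_apply, Equiv.symm_symm]
  refine ⟨w.reindex e.symm, fun b => ⟨α (e b), ?_⟩, fun b => ⟨β (e b), ?_⟩⟩ <;> rw [hw_apply]
  · exact congrArg WithLp.ofLp (mem_eigenspace_iff.1 (hαβ (e b)).1)
  · exact congrArg WithLp.ofLp (mem_eigenspace_iff.1 (hαβ (e b)).2)

theorem IsEigenbasis.isEigensystem (hv : IsEigenbasis v A) (hA : A.IsHermitian) :
    IsEigensystem A v fun b => prob A (basisMeasurement v b) := fun b => by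
  classical
  obtain ⟨μ, hμ⟩ := hv b
  have hμ_eq : (prob A (basisMeasurement v b) : ℂ) = μ := by
    rw [ofReal_prob hA ((isPOVM_basisMeasurement v).posSemidef b).isHermitian, basisMeasurement,
      Matrix.mul_vecMulVec, hμ, Matrix.trace_vecMulVec, smul_dotProduct,
      ← EuclideanSpace.inner_eq_star_dotProduct]
    simp
  rw [hμ_eq, hμ]

variable [DecidableEq n]

theorem IsEigenbasis.shannon_basisMeasurement (hv : IsEigenbasis v A) (hA : A.IsHermitian) :
    shannon (fun b => prob A (basisMeasurement v b)) = vonNeumannEntropy hA :=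
  ((hv.isEigensystem hA).vonNeumannEntropy_eq hA).symm

theorem mutualInfo_joint_eigenbasis (h₀ : IsEigenbasis v ρ₀.op) (h₁ : IsEigenbasis v ρ₁.op)
    (t : ℝ) : mutualInfo ρ₀ ρ₁ (basisMeasurement v) t = holevo ρ₀ ρ₁ t := by
  rw [mutualInfo, holevo,
    (isEigenbasis_mean h₀ h₁ t).shannon_basisMeasurement (mean_isHermitian ρ₀ ρ₁ t),
    h₀.shannon_basisMeasurement ρ₀.posSemidef.isHermitian,
    h₁.shannon_basisMeasurement ρ₁.posSemidef.isHermitian]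

theorem holevo_le_accessibleInfo (h : Commute ρ₀.op ρ₁.op) (t : ℝ) :
    holevo ρ₀ ρ₁ t ≤ accessibleInfo ρ₀ ρ₁ t := by
  obtain ⟨v, h₀, h₁⟩ := exists_joint_eigenbasis ρ₀.posSemidef.isHermitian
    ρ₁.posSemidef.isHermitian h
  rw [← mutualInfo_joint_eigenbasis h₀ h₁ t]
  exact (isGreatest_accessibleInfo ρ₀ ρ₁ t).2
    ((isPOVM_basisMeasurement v).mutualInfo_mem ρ₀ ρ₁ t)

theorem accessibleInfo_le_holevo (ρ₀ ρ₁ : DensityOperator n) (ht : t ∈ Icc (0 : ℝ) 1) :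
    accessibleInfo ρ₀ ρ₁ t ≤ holevo ρ₀ ρ₁ t := by
  obtain ⟨L, hL⟩ := exists_isCurvatureBound ρ₀ ρ₁
  exact (hL.accessibleInfo_le ht).trans (hL.le_holevo ht)

theorem accessibleInfo_eq_holevo_iff (ht : t ∈ Ioo (0 : ℝ) 1) :
    accessibleInfo ρ₀ ρ₁ t = holevo ρ₀ ρ₁ t ↔ Commute ρ₀.op ρ₁.op :=
  ⟨commute_of_accessibleInfo_eq_holevo ht, fun h =>
    (accessibleInfo_le_holevo ρ₀ ρ₁ (Ioo_subset_Icc_self ht)).antisymm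
      (holevo_le_accessibleInfo h t)⟩

end JointEigenbasis

end BinaryChannel

theorem mainTheorem3 {n : Type*} [Fintype n] [DecidableEq n]
    (ρ₀ ρ₁ : BinaryChannel.DensityOperator n) :
    -- for `0 < t < 1`, the operator `𝓛_ρ(Δ)` is Hermitian and solves its defining equation
    (∀ t ∈ Set.Ioo (0 : ℝ) 1,
      (BinaryChannel.loweredDiff ρ₀ ρ₁ t).IsHermitian ∧
      (1 / 2 : ℂ) • (BinaryChannel.mean ρ₀ ρ₁ t * BinaryChannel.loweredDiff ρ₀ ρ₁ t
        + BinaryChannel.loweredDiff ρ₀ ρ₁ t * BinaryChannel.mean ρ₀ ρ₁ t)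
        = BinaryChannel.diff ρ₀ ρ₁) ∧
    -- the mutual information of every measurement is twice differentiable on `(0,1)`
    (∀ (N : ℕ) (E : Fin N → Matrix n n ℂ), BinaryChannel.IsPOVM E →
      ∀ t ∈ Set.Ioo (0 : ℝ) 1, ContDiffAt ℝ 2 (BinaryChannel.mutualInfo ρ₀ ρ₁ E) t) ∧
    -- `-tr(Δ 𝓛_ρ(Δ))` is the minimum of `J''(t)` over all measurements
    (∀ t ∈ Set.Ioo (0 : ℝ) 1,
      IsLeast (BinaryChannel.mutualInfoSecondDerivValues ρ₀ ρ₁ t)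
        (BinaryChannel.curvature ρ₀ ρ₁ t)) ∧
    -- and the minimum is attained by measuring in any eigenbasis of `𝓛_ρ(Δ)`
    (∀ t ∈ Set.Ioo (0 : ℝ) 1, ∀ v : OrthonormalBasis n ℂ (EuclideanSpace ℂ n),
      BinaryChannel.IsEigenbasis v (BinaryChannel.loweredDiff ρ₀ ρ₁ t) →
      BinaryChannel.IsPOVM (BinaryChannel.basisMeasurement v) ∧
      ContDiffAt ℝ 2
        (BinaryChannel.mutualInfo ρ₀ ρ₁ (BinaryChannel.basisMeasurement v)) t ∧
      iteratedDeriv 2 (BinaryChannel.mutualInfo ρ₀ ρ₁ (BinaryChannel.basisMeasurement v)) t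
        = BinaryChannel.curvature ρ₀ ρ₁ t) ∧
    -- the accessible information is a maximum
    (∀ t ∈ Set.Icc (0 : ℝ) 1,
      IsGreatest (BinaryChannel.mutualInfoValues ρ₀ ρ₁ t)
        (BinaryChannel.accessibleInfo ρ₀ ρ₁ t)) ∧
    -- the function `L` exists, is unique on `[0,1]`, and satisfies `I ≤ L ≤ S`
    (∃ L : ℝ → ℝ, BinaryChannel.IsCurvatureBound ρ₀ ρ₁ L ∧
      (∀ L' : ℝ → ℝ, BinaryChannel.IsCurvatureBound ρ₀ ρ₁ L' → Set.EqOn L' L (Set.Icc 0 1)) ∧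
      ∀ t ∈ Set.Icc (0 : ℝ) 1,
        BinaryChannel.accessibleInfo ρ₀ ρ₁ t ≤ L t ∧ L t ≤ BinaryChannel.holevo ρ₀ ρ₁ t) ∧
    -- equality in the Holevo bound
    (∀ t ∈ Set.Ioo (0 : ℝ) 1,
      BinaryChannel.accessibleInfo ρ₀ ρ₁ t = BinaryChannel.holevo ρ₀ ρ₁ t ↔
        Commute ρ₀.op ρ₁.op) := by
  refine ⟨fun t ht => ⟨BinaryChannel.loweredDiff_isHermitian ρ₀ ρ₁ t, ?_⟩,
    fun _ _ hE _ ht => BinaryChannel.contDiffAt_mutualInfo hE ht,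
    fun _ ht => BinaryChannel.isLeast_curvature ht,
    fun _ ht v hv => ⟨BinaryChannel.isPOVM_basisMeasurement v,
      BinaryChannel.contDiffAt_mutualInfo (BinaryChannel.isPOVM_basisMeasurement v) ht,
      BinaryChannel.iteratedDeriv_two_mutualInfo_eigenbasis hv ht⟩,
    fun t _ => BinaryChannel.isGreatest_accessibleInfo ρ₀ ρ₁ t, ?_,
    fun _ ht => BinaryChannel.accessibleInfo_eq_holevo_iff ht⟩
  · rw [BinaryChannel.mean_mul_loweredDiff_add ht, smul_smul]
    norm_num
  · obtain ⟨L, hL⟩ := BinaryChannel.exists_isCurvatureBound ρ₀ ρ₁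
    exact ⟨L, hL, fun L' hL' t ht => le_antisymm (hL'.le_of_isCurvatureBound hL ht)
      (hL.le_of_isCurvatureBound hL' ht), fun t ht => ⟨hL.accessibleInfo_le ht, hL.le_holevo ht⟩⟩
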